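/- For a prime $p$ let $|\cdot|$ be the $p$-adic absolute value on $\mathbb Q_p$, let $dz$ be the Haar measure on $\mathbb Z_p^n$ of total mass $1$, and let $\mathrm e:\mathbb Q_p\to\mathbb C$ be the standard character $\mathrm e(z)=e^{2\pi i L(z)}$, where $L(z)=a_{-M}p^{-M}+\cdots+a_{-1}p^{-1}$ is the polar part of the digit expansion $z=\sum_{j\ge -M}a_jp^j$, $a_j\in\{0,\dots,p-1\}$. For $P\in\mathbb Q_p[X_1,\dots,X_n]$ and $z\in\mathbb Z_p^n$ put $$H(z)=\max_{|\alpha|\ge 1}\left|\frac{\partial^\alpha P(z)}{\alpha!}\right|^{1/|\alpha|},\qquad H_P=\inf_{z\in\mathbb Z_p^n}H(z),$$ where $\alpha$ runs over the multi-indices in $\mathbb N_0^n$, and for real $H>0$ put $$I_P(H)=\int_{\{z\in\mathbb Z_p^n:\ H\le H(z)\}}\mathrm e(P(z))\,dz,\qquad I_P=\int_{\mathbb Z_p^n}\mathrm e(P(z))\,dz .$$ For all $d$ and $n$ there is a constant $C_{d,n}>0$, depending only on $d$ and $n$, such that for every prime $p$ and every $P\in\mathbb Q_p[X_1,\dots,X_n]$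 of degree $d$: 1. $|I_P(H)|\le C_{d,n}\,p\,H^{-1}$ for every real $H>0$; 2. if $d\ge 1$, then $H_P>0$ and $|I_P|\le C_{d,n}\,p\,H_P^{-1}$. -/

import Mathlib

noncomputable section

open MeasureTheory

namespace PadicOsc

variable {p : ℕ} [Fact p.Prime]

/-- The number `M` of digits of `z` at negative powers of `p`: `p ^ M = max (|z|, 1)`. -/
def negDigits (z : ℚ_[p]) : ℕ := (-z.valuation).toNat

theorem norm_shift_le_one (z : ℚ_[p]) : ‖(p : ℚ_[p]) ^ negDigits z * z‖ ≤ 1 := by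
  by_cases hz : z = 0
  · simp [hz]
  have hp : (1 : ℝ) < p := by exact_mod_cast (Fact.out : p.Prime).one_lt
  rw [norm_mul, norm_pow, Padic.norm_p, Padic.norm_eq_zpow_neg_valuation hz, inv_pow,
    ← zpow_natCast, ← zpow_neg, ← zpow_add₀ (by positivity)]
  refine zpow_le_one_of_nonpos₀ hp.le ?_
  have := Int.self_le_toNat (-z.valuation)
  unfold negDigits
  omega

/-- The polar part `L(z) = a_{-M} p^{-M} + ⋯ + a_{-1} p^{-1}` of the digit expansion
`z = ∑_{j ≥ -M} a_j p^j`.  Here `PadicInt.appr x M` is the natural number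
`x_0 + x_1 p + ⋯ + x_{M-1} p^{M-1}` formed from the first `M` digits of the `p`-adic integer `x`;
it is the unique natural number below `p ^ M` that is congruent to `x` modulo `p ^ M`. -/
def polarPart (z : ℚ_[p]) : ℚ :=
  (PadicInt.appr (⟨(p : ℚ_[p]) ^ negDigits z * z, norm_shift_le_one z⟩ : ℤ_[p]) (negDigits z) : ℚ)
    / (p : ℚ) ^ negDigits z

/-- The standard character `e(z) = exp (2 π i L(z))` of the `p`-adic field. -/
def stdChar (z : ℚ_[p]) : ℂ :=
  Complex.exp (2 * Real.pi * Complex.I * ((polarPart z : ℚ) : ℂ))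

instance instMeasurableSpacePadicInt : MeasurableSpace ℤ_[p] := borel _

instance instBorelSpacePadicInt : BorelSpace ℤ_[p] := ⟨rfl⟩

variable (p) in
/-- The Haar measure on `ℤ_p`, normalized to have total mass one. -/
def haar : Measure ℤ_[p] := Measure.addHaarMeasure ⊤

instance instIsProbabilityMeasureHaar : IsProbabilityMeasure (haar p) :=
  ⟨by simpa [haar] using Measure.addHaarMeasure_self (K₀ := (⊤ : TopologicalSpace.PositiveCompacts ℤ_[p]))⟩

variable (p) in
/-- The normalized Haar measure on `ℤ_p ^ n` (the product of the one-dimensional ones). -/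
def haarN (n : ℕ) : Measure (Fin n → ℤ_[p]) := Measure.pi fun _ => haar p

variable {n : ℕ}

/-- The value `P(z)` at a point `z` of `ℤ_p ^ n`. -/
def evalAt (P : MvPolynomial (Fin n) ℚ_[p]) (z : Fin n → ℤ_[p]) : ℚ_[p] :=
  MvPolynomial.eval (fun i => (z i : ℚ_[p])) P

/-- The partial derivative `∂^α P`, a composition of first order partial derivatives. -/
def partialD (α : Fin n → ℕ) (P : MvPolynomial (Fin n) ℚ_[p]) : MvPolynomial (Fin n) ℚ_[p] :=
  (List.finRange n).foldr (fun i Q => (MvPolynomial.pderiv i)^[α i] Q) P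

/-- `|∂^α P(z) / α!| ^ (1 / |α|)`. -/
def derivSize (P : MvPolynomial (Fin n) ℚ_[p]) (z : Fin n → ℤ_[p]) (α : Fin n → ℕ) : ℝ :=
  ‖evalAt (partialD α P) z / ((∏ i, (α i).factorial : ℕ) : ℚ_[p])‖ ^ (1 / ((∑ i, α i : ℕ) : ℝ))

/-- `H(z) = max_{|α| ≥ 1} |∂^α P(z) / α!| ^ (1 / |α|)`. -/
def Hfun (P : MvPolynomial (Fin n) ℚ_[p]) (z : Fin n → ℤ_[p]) : ℝ :=
  ⨆ α : {α : Fin n → ℕ // 1 ≤ ∑ i, α i}, derivSize P z α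

/-- `H_P = inf_z H(z)`, the infimum over `z ∈ ℤ_p ^ n`. -/
def Hinf (P : MvPolynomial (Fin n) ℚ_[p]) : ℝ := ⨅ z : Fin n → ℤ_[p], Hfun P z

/-- The local oscillatory integral `I_P(H)`. -/
def localOscInt (P : MvPolynomial (Fin n) ℚ_[p]) (H : ℝ) : ℂ :=
  ∫ z in {z : Fin n → ℤ_[p] | H ≤ Hfun P z}, stdChar (evalAt P z) ∂(haarN p n)

/-- The complete oscillatory integral `I_P`. -/
def oscInt (P : MvPolynomial (Fin n) ℚ_[p]) : ℂ :=
  ∫ z : Fin n → ℤ_[p], stdChar (evalAt P z) ∂(haarN p n)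

/-! ### The objects above are well defined -/

theorem norm_sub_polarPart_le_one (z : ℚ_[p]) : ‖z - ((polarPart z : ℚ) : ℚ_[p])‖ ≤ 1 := by
  have hp0 : (p : ℚ_[p]) ≠ 0 := by exact_mod_cast (Fact.out : p.Prime).ne_zero
  set x : ℤ_[p] := ⟨(p : ℚ_[p]) ^ negDigits z * z, norm_shift_le_one z⟩ with hx
  obtain ⟨c, hc⟩ := Ideal.mem_span_singleton'.1 (PadicInt.appr_spec (negDigits z) x)
  have h2 : (p : ℚ_[p]) ^ negDigits z * z - (x.appr (negDigits z) : ℚ_[p])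
      = (c : ℚ_[p]) * (p : ℚ_[p]) ^ negDigits z := by
    have := congrArg (fun y : ℤ_[p] => (y : ℚ_[p])) hc
    push_cast at this
    rw [this]
  have h3 : z - ((polarPart z : ℚ) : ℚ_[p]) = c := by
    have hpow : (p : ℚ_[p]) ^ negDigits z ≠ 0 := pow_ne_zero _ hp0
    have h4 : ((polarPart z : ℚ) : ℚ_[p])
        = (x.appr (negDigits z) : ℚ_[p]) / (p : ℚ_[p]) ^ negDigits z := by
      rw [polarPart]; push_cast; rfl
    rw [h4]
    field_simp
    linear_combination h2
  rw [h3]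
  exact c.2

theorem norm_stdChar (z : ℚ_[p]) : ‖stdChar z‖ = 1 := by
  have : (2 * Real.pi * Complex.I * ((polarPart z : ℚ) : ℂ))
      = ((2 * Real.pi * (polarPart z : ℚ) : ℝ) : ℂ) * Complex.I := by
    push_cast; ring
  rw [stdChar, this, Complex.norm_exp_ofReal_mul_I]

/-- The character depends on its argument modulo `ℤ_p` only. -/
theorem stdChar_eq_of_norm_sub_le_one {x y : ℚ_[p]} (h : ‖x - y‖ ≤ 1) :
    stdChar x = stdChar y := by
  have hp0 : (p : ℚ) ≠ 0 := by exact_mod_cast (Fact.out : p.Prime).ne_zero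
  set q : ℚ := polarPart x - polarPart y with hq
  have hqn : ‖((q : ℚ) : ℚ_[p])‖ ≤ 1 := by
    have e : ((q : ℚ) : ℚ_[p])
        = (x - y) + (-(x - ((polarPart x : ℚ) : ℚ_[p])) + (y - ((polarPart y : ℚ) : ℚ_[p]))) := by
      rw [hq]; push_cast; ring
    rw [e]
    refine (Padic.nonarchimedean _ _).trans (max_le h ?_)
    refine (Padic.nonarchimedean _ _).trans (max_le ?_ (norm_sub_polarPart_le_one y))
    rw [norm_neg]
    exact norm_sub_polarPart_le_one x
  -- `q` has denominator a power of `p` and is `p`-integral, hence an integer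
  obtain ⟨a, k, hak⟩ : ∃ (a : ℤ) (k : ℕ), q = a / (p : ℚ) ^ k := by
    have key : ∀ w : ℚ_[p], ∃ b : ℤ, polarPart w = b / (p : ℚ) ^ negDigits w :=
      fun w => ⟨_, by rw [polarPart, ← Int.cast_natCast]⟩
    obtain ⟨b, hb⟩ := key x
    obtain ⟨c, hc⟩ := key y
    refine ⟨b * p ^ negDigits y - c * p ^ negDigits x, negDigits x + negDigits y, ?_⟩
    rw [hq, hb, hc]
    push_cast
    field_simp
    ring
  have hdvd : (p : ℤ) ^ k ∣ a := by
    have h1 : ((a : ℤ) : ℚ_[p]) = ((q : ℚ) : ℚ_[p]) * (p : ℚ_[p]) ^ k := by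
      have : (a : ℚ) = q * (p : ℚ) ^ k := by rw [hak]; field_simp
      have := congrArg (fun t : ℚ => (t : ℚ_[p])) this
      push_cast at this
      exact this
    have h2 : ‖((a : ℤ) : ℚ_[p])‖ ≤ (p : ℝ) ^ (-(k : ℤ)) := by
      rw [h1, norm_mul, Padic.norm_p_pow]
      exact mul_le_of_le_one_left (by positivity) hqn
    exact_mod_cast (Padic.norm_int_le_pow_iff_dvd a k).1 h2
  obtain ⟨m, hm⟩ := hdvd
  have hqm : polarPart x = polarPart y + m := by
    have : q = m := by
      rw [hak, hm]; push_cast; field_simp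
    rw [← this, hq]; ring
  rw [stdChar, stdChar, hqm, Complex.exp_eq_exp_iff_exists_int]
  exact ⟨m, by push_cast; ring⟩

theorem continuous_stdChar : Continuous (stdChar : ℚ_[p] → ℂ) := by
  refine IsLocallyConstant.continuous ((IsLocallyConstant.iff_eventually_eq _).2 fun x => ?_)
  filter_upwards [Metric.ball_mem_nhds x one_pos] with y hy
  exact stdChar_eq_of_norm_sub_le_one (by rw [← dist_eq_norm]; exact (Metric.mem_ball.1 hy).le)

instance instIsProbabilityMeasureHaarN (n : ℕ) : IsProbabilityMeasure (haarN p n) := by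
  unfold haarN; infer_instance

theorem continuous_evalAt (P : MvPolynomial (Fin n) ℚ_[p]) : Continuous (evalAt P) :=
  (MvPolynomial.continuous_eval P).comp
    (continuous_pi fun i => continuous_subtype_val.comp (continuous_apply i))

theorem measurableSet_le_Hfun (P : MvPolynomial (Fin n) ℚ_[p]) (H : ℝ) :
    MeasurableSet {z : Fin n → ℤ_[p] | H ≤ Hfun P z} := by
  refine measurableSet_le measurable_const ?_
  refine Measurable.iSup fun α => Continuous.measurable ?_
  unfold derivSize
  exact (((continuous_evalAt _).div_const _).norm).rpow_const fun _ => Or.inr (by positivity)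

theorem integrable_stdChar_evalAt (P : MvPolynomial (Fin n) ℚ_[p]) :
    Integrable (fun z : Fin n → ℤ_[p] => stdChar (evalAt P z)) (haarN p n) :=
  Integrable.of_bound (continuous_stdChar.comp (continuous_evalAt P)).aestronglyMeasurable 1
    (Filter.Eventually.of_forall fun _ => (norm_stdChar _).le)

/-- First order derivatives lower the degree. -/
theorem coeff_pderiv_eq_zero {Q : MvPolynomial (Fin n) ℚ_[p]} {k : ℕ}
    (hQ : ∀ m : Fin n →₀ ℕ, k ≤ m.degree → Q.coeff m = 0) (i : Fin n) (m : Fin n →₀ ℕ)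
    (hm : k - 1 ≤ m.degree) : (MvPolynomial.pderiv i Q).coeff m = 0 := by
  rw [MvPolynomial.coeff_pderiv, hQ, zero_mul]
  simp only [map_add, Finsupp.degree_single]
  omega

theorem coeff_iterate_pderiv_eq_zero (i : Fin n) (a : ℕ) {Q : MvPolynomial (Fin n) ℚ_[p]} {k : ℕ}
    (hQ : ∀ m : Fin n →₀ ℕ, k ≤ m.degree → Q.coeff m = 0) (m : Fin n →₀ ℕ)
    (hm : k - a ≤ m.degree) : ((MvPolynomial.pderiv i)^[a] Q).coeff m = 0 := by
  induction a generalizing m with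
  | zero => exact hQ m hm
  | succ a ih =>
    rw [Function.iterate_succ_apply']
    exact coeff_pderiv_eq_zero ih i m (by omega)

/-- Derivatives of order exceeding the degree vanish. -/
theorem partialD_eq_zero (P : MvPolynomial (Fin n) ℚ_[p]) (α : Fin n → ℕ)
    (h : P.totalDegree < ∑ i, α i) : partialD α P = 0 := by
  have key : ∀ (l : List (Fin n)) (m : Fin n →₀ ℕ),
      P.totalDegree + 1 - (l.map α).sum ≤ m.degree →
      (l.foldr (fun i Q => (MvPolynomial.pderiv i)^[α i] Q) P).coeff m = 0 := by
    intro l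
    induction l with
    | nil =>
      intro m hm
      rw [List.foldr_nil]
      refine MvPolynomial.coeff_eq_zero_of_totalDegree_lt ?_
      simp only [List.map_nil, List.sum_nil, Finsupp.degree_apply] at hm
      omega
    | cons i l ih =>
      intro m hm
      rw [List.map_cons, List.sum_cons] at hm
      exact coeff_iterate_pderiv_eq_zero i (α i) ih m (by omega)
  ext m
  rw [MvPolynomial.coeff_zero]
  refine key _ m ?_
  rw [← List.ofFn_eq_map, List.sum_ofFn]
  omega

/-- The family whose supremum is `H(z)` is bounded, with only finitely many nonzero members. -/
theorem bddAbove_derivSize (P : MvPolynomial (Fin n) ℚ_[p]) (z : Fin n → ℤ_[p]) :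
    BddAbove (Set.range fun α : {α : Fin n → ℕ // 1 ≤ ∑ i, α i} => derivSize P z α) := by
  have hfin : (derivSize P z '' Set.Iic (fun _ => P.totalDegree) ∪ {0}).Finite :=
    ((Set.finite_Iic _).image _).union (Set.finite_singleton 0)
  refine hfin.bddAbove.mono ?_
  rintro _ ⟨⟨α, hα⟩, rfl⟩
  by_cases h : P.totalDegree < ∑ i, α i
  · right
    have : ((∑ i, α i : ℕ) : ℝ) ≠ 0 := by exact_mod_cast (by omega : (∑ i, α i) ≠ 0)
    simp only [derivSize, partialD_eq_zero P α h, evalAt, map_zero, zero_div, norm_zero,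
      Set.mem_singleton_iff]
    exact Real.zero_rpow (one_div_ne_zero this)
  · left
    exact ⟨α, fun i => (Finset.single_le_sum (f := α) (fun _ _ => Nat.zero_le _)
      (Finset.mem_univ i)).trans (not_lt.1 h), rfl⟩

end PadicOsc

end

noncomputable section

open MeasureTheory

namespace PadicOsc

variable {p : ℕ} [Fact p.Prime] {n : ℕ}

/-! Take `H > p`, the bound being trivial otherwise. Round `H(z)` to a scale: `p ^ t < H(z) ≤ p ^ (t
+ 1)`. This rounding costs the factor `p` in the theorem.

If the Taylor coefficients at `z` satisfy `|c_m| ≤ p ^ (t|m|)` for all `|m| ≥ 2`, then modulo `ℤ_p`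
the polynomial is affine on `z + p ^ t ℤ_p ^ n`, and some first order coefficient has size exactly
`p ^ (t + 1)`. The character then sums to zero over the translates by `k p ^ t e_i`, `0 ≤ k < p`.
The set of such points, sorted by `t` and by the first large index `i` (`regularSet`), is invariant
under `p ^ t ℤ_p ^ n`, so the integral over it vanishes (`setIntegral_regularSet`).

At every remaining point some `c_m` with `2 ≤ |m| ≤ d` exceeds `p ^ (t|m|)`, while the gradient is
at most `p ^ (t + 1)` (`exists_mem_singularSet`). Hence `∂^m P` is larger than `A ^ (|m| - 1)` times
a first order derivative, with `A` comparable to `H / p`. Along the chain of derivatives joining the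
two, some consecutive quotient exceeds `A`. On a coordinate line such a quotient is a logarithmic
derivative `g' / g = ∑ 1 / (x - ξ)` over the roots of `g`; by the ultrametric inequality it exceeds
`A` only within `1 / A` of a root, a set of measure at most `deg g / A` (`haar_logDeriv_le`). By
Fubini the exceptional set has measure `O(p / H)`.

The complete integral is the case `H = H_P`, which is positive because the top degree Taylor
coefficients do not depend on `z`. -/

/-! ### The standard character: additivity, kernel, orthogonality. -/

/-- A rational number whose denominator is a power of `p` and which is `p`-integral is an
integer. -/
theorem exists_int_of_norm_le_one {q : ℚ} {a : ℤ} {k : ℕ} (hq : q = a / (p : ℚ) ^ k)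
    (h : ‖((q : ℚ) : ℚ_[p])‖ ≤ 1) : ∃ m : ℤ, q = m := by
  have hp0 : (p : ℚ) ≠ 0 := by exact_mod_cast (Fact.out : p.Prime).ne_zero
  have hdvd : (p : ℤ) ^ k ∣ a := by
    have h1 : ((a : ℤ) : ℚ_[p]) = ((q : ℚ) : ℚ_[p]) * (p : ℚ_[p]) ^ k := by
      have : (a : ℚ) = q * (p : ℚ) ^ k := by rw [hq]; field_simp
      have := congrArg (fun t : ℚ => (t : ℚ_[p])) this
      push_cast at this
      exact this
    have h2 : ‖((a : ℤ) : ℚ_[p])‖ ≤ (p : ℝ) ^ (-(k : ℤ)) := by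
      rw [h1, norm_mul, Padic.norm_p_pow]
      exact mul_le_of_le_one_left (by positivity) h
    exact_mod_cast (Padic.norm_int_le_pow_iff_dvd a k).1 h2
  obtain ⟨m, hm⟩ := hdvd
  exact ⟨m, by rw [hq, hm]; push_cast; field_simp⟩

theorem polarPart_eq_div (z : ℚ_[p]) :
    ∃ b : ℤ, polarPart z = b / (p : ℚ) ^ negDigits z :=
  ⟨_, by rw [polarPart, ← Int.cast_natCast]⟩

/-- The defect of additivity of the polar part has a power of `p` as denominator and is
`p`-integral, so it is an integer and `exp` does not see it. -/
theorem stdChar_add (x y : ℚ_[p]) : stdChar (x + y) = stdChar x * stdChar y := by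
  have hp0 : (p : ℚ) ≠ 0 := by exact_mod_cast (Fact.out : p.Prime).ne_zero
  obtain ⟨a, ha⟩ := polarPart_eq_div (x + y)
  obtain ⟨b, hb⟩ := polarPart_eq_div x
  obtain ⟨c, hc⟩ := polarPart_eq_div y
  obtain ⟨m, hm⟩ : ∃ m : ℤ, polarPart (x + y) - polarPart x - polarPart y = m := by
    refine exists_int_of_norm_le_one (p := p)
      (a := a * p ^ negDigits x * p ^ negDigits y - b * p ^ negDigits (x + y) * p ^ negDigits y
        - c * p ^ negDigits (x + y) * p ^ negDigits x)
      (k := negDigits (x + y) + negDigits x + negDigits y) ?_ ?_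
    · rw [ha, hb, hc]
      have := pow_ne_zero (negDigits x) hp0
      have := pow_ne_zero (negDigits y) hp0
      have := pow_ne_zero (negDigits (x + y)) hp0
      push_cast
      rw [pow_add, pow_add]
      field_simp
    · have e : (((polarPart (x + y) - polarPart x - polarPart y : ℚ)) : ℚ_[p])
          = (x - ((polarPart x : ℚ) : ℚ_[p])) + ((y - ((polarPart y : ℚ) : ℚ_[p]))
            + -((x + y) - ((polarPart (x + y) : ℚ) : ℚ_[p]))) := by
        push_cast; ring
      rw [e]
      refine (Padic.nonarchimedean _ _).trans (max_le (norm_sub_polarPart_le_one x) ?_)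
      refine (Padic.nonarchimedean _ _).trans (max_le (norm_sub_polarPart_le_one y) ?_)
      rw [norm_neg]
      exact norm_sub_polarPart_le_one _
  have hs : polarPart (x + y) = polarPart x + polarPart y + m := by rw [← hm]; ring
  rw [stdChar, stdChar, stdChar, ← Complex.exp_add, hs, Complex.exp_eq_exp_iff_exists_int]
  exact ⟨m, by push_cast; ring⟩

theorem stdChar_zero : stdChar (0 : ℚ_[p]) = 1 := by
  have h := stdChar_add (0 : ℚ_[p]) 0
  rw [add_zero] at h
  have h0 : stdChar (0 : ℚ_[p]) ≠ 0 := by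
    rw [← norm_ne_zero_iff, norm_stdChar]
    exact one_ne_zero
  exact (mul_eq_left₀ h0).1 h.symm

theorem stdChar_eq_one_of_norm_le_one {x : ℚ_[p]} (h : ‖x‖ ≤ 1) : stdChar x = 1 := by
  rw [stdChar_eq_of_norm_sub_le_one (y := 0) (by rwa [sub_zero]), stdChar_zero]

theorem stdChar_natCast_mul (k : ℕ) (x : ℚ_[p]) : stdChar ((k : ℚ_[p]) * x) = stdChar x ^ k := by
  induction k with
  | zero => rw [Nat.cast_zero, zero_mul, pow_zero, stdChar_zero]
  | succ k ih => rw [Nat.cast_succ, add_mul, one_mul, stdChar_add, ih, pow_succ]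

theorem norm_le_one_of_stdChar_eq_one {x : ℚ_[p]} (h : stdChar x = 1) : ‖x‖ ≤ 1 := by
  rw [stdChar, Complex.exp_eq_one_iff] at h
  obtain ⟨m, hm⟩ := h
  have hpi : (2 * Real.pi * Complex.I : ℂ) ≠ 0 := Complex.two_pi_I_ne_zero
  have h1 : ((polarPart x : ℚ) : ℂ) = m := by
    apply mul_left_cancel₀ hpi
    rw [hm]; ring
  have h2 : polarPart x = m := by exact_mod_cast h1
  have h3 := norm_sub_polarPart_le_one x
  have e : x = (x - ((polarPart x : ℚ) : ℚ_[p])) + ((m : ℤ) : ℚ_[p]) := by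
    rw [h2]; push_cast; ring
  rw [e]
  exact (Padic.nonarchimedean _ _).trans (max_le h3 (Padic.norm_int_le_one m))

/-- A nontrivial character of order `p` sums to zero. -/
theorem sum_stdChar_natCast_mul_eq_zero {x : ℚ_[p]} (h1 : 1 < ‖x‖) (h2 : ‖x‖ ≤ p) :
    ∑ k ∈ Finset.range p, stdChar ((k : ℚ_[p]) * x) = 0 := by
  simp_rw [stdChar_natCast_mul]
  have hne : stdChar x ≠ 1 := fun h => absurd (norm_le_one_of_stdChar_eq_one h) (not_le.2 h1)
  have hp : (0 : ℝ) < p := by exact_mod_cast (Fact.out : p.Prime).pos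
  have hpow : stdChar x ^ p = 1 := by
    rw [← stdChar_natCast_mul]
    refine stdChar_eq_one_of_norm_le_one ?_
    rw [norm_mul, Padic.norm_p, inv_mul_le_iff₀ hp, mul_one]
    exact h2
  rw [geom_sum_eq hne, hpow, sub_self, zero_div]

/-! ### Haar measure of balls in `ℤ_p`. -/

instance instIsAddHaarMeasureHaar : (haar p).IsAddHaarMeasure := by
  unfold haar; infer_instance

/-- The balls centred at `0, …, p ^ m - 1` are disjoint translates of one another inside a space of
mass one. -/
theorem haar_closedBall_pow_le (a : ℤ_[p]) (m : ℕ) :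
    haar p {t | ‖t - a‖ ≤ (p : ℝ) ^ (-(m : ℤ))} ≤ ((p : ENNReal) ^ m)⁻¹ := by
  have hp0 : (p : ENNReal) ≠ 0 := by exact_mod_cast (Fact.out : p.Prime).ne_zero
  set B : ℤ_[p] → Set ℤ_[p] := fun b => {t | ‖t - b‖ ≤ (p : ℝ) ^ (-(m : ℤ))} with hB
  have hmeas : ∀ b, MeasurableSet (B b) := fun b =>
    (isClosed_le (continuous_norm.comp (continuous_id.sub continuous_const))
      continuous_const).measurableSet
  have htrans : ∀ b, haar p (B b) = haar p (B a) := by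
    intro b
    have : B b = (fun t => (a - b) + t) ⁻¹' B a := by
      ext t
      simp only [hB, Set.mem_ofPred_eq, Set.mem_preimage]
      rw [show a - b + t - a = t - b by ring]
    rw [this, measure_preimage_add]
  have hdisj : (↑(Finset.range (p ^ m)) : Set ℕ).PairwiseDisjoint fun i : ℕ => B i := by
    intro i hi j hj hij
    refine Set.disjoint_left.2 fun t hti htj => hij ?_
    have h1 : ‖((i - j : ℤ) : ℤ_[p])‖ ≤ (p : ℝ) ^ (-(m : ℤ)) := by
      have e : ((i - j : ℤ) : ℤ_[p]) = (t - j) + -(t - i) := by push_cast; ring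
      rw [e]
      refine (PadicInt.nonarchimedean _ _).trans (max_le htj ?_)
      rw [norm_neg]; exact hti
    have h2 := (PadicInt.norm_int_le_pow_iff_dvd).1 h1
    simp only [Finset.coe_range, Set.mem_Iio] at hi hj
    have h3 := (Nat.modEq_iff_dvd (a := j) (b := i) (n := p ^ m)).2 (by exact_mod_cast h2)
    exact (Nat.ModEq.eq_of_lt_of_lt h3 hj hi).symm
  have hsum : ∑ i ∈ Finset.range (p ^ m), haar p (B i) ≤ 1 := by
    rw [← measure_biUnion_finset hdisj fun i _ => hmeas _]
    exact prob_le_one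
  simp only [htrans, Finset.sum_const, Finset.card_range, nsmul_eq_mul, Nat.cast_pow] at hsum
  rw [ENNReal.le_inv_iff_mul_le, mul_comm]
  exact hsum

/-- A ball of radius `r` in `ℤ_p` has measure at most `r`. -/
theorem haar_closedBall_le (a : ℤ_[p]) {r : ℝ} (hr : 0 < r) :
    haar p {t | ‖t - a‖ ≤ r} ≤ ENNReal.ofReal r := by
  rcases le_or_gt 1 r with h1 | h1
  · exact prob_le_one.trans (by simpa using ENNReal.ofReal_le_ofReal h1)
  have hp : 1 < (p : ℝ) := by exact_mod_cast (Fact.out : p.Prime).one_lt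
  have hp0 : (0 : ℝ) < p := by linarith
  have hex : ∃ m : ℕ, (p : ℝ) ^ (-(m : ℤ)) ≤ r := by
    obtain ⟨m, hm⟩ := exists_pow_lt_of_lt_one hr (inv_lt_one_of_one_lt₀ hp)
    exact ⟨m, by rw [zpow_neg, zpow_natCast, ← inv_pow]; exact hm.le⟩
  classical
  set m := Nat.find hex with hm
  have hm1 : (p : ℝ) ^ (-(m : ℤ)) ≤ r := Nat.find_spec hex
  have hm0 : m ≠ 0 := by
    intro h0
    rw [h0] at hm1
    simp only [Nat.cast_zero, neg_zero, zpow_zero] at hm1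
    linarith
  have hm2 : r < (p : ℝ) ^ (-(m : ℤ) + 1) := by
    have := Nat.find_min hex (m := m - 1) (by omega)
    rw [not_le] at this
    rw [Nat.cast_sub (Nat.one_le_iff_ne_zero.2 hm0)] at this
    rw [show -(m : ℤ) + 1 = -((m : ℤ) - ((1 : ℕ) : ℤ)) by push_cast; ring]
    exact this
  -- Norms take only powers of `p` as nonzero values, so by minimality of `m` the radius `r` may be
  -- rounded down to `p ^ (-m)`.
  have hsub : {t | ‖t - a‖ ≤ r} ⊆ {t | ‖t - a‖ ≤ (p : ℝ) ^ (-(m : ℤ))} := fun t ht =>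
    (PadicInt.norm_le_pow_iff_norm_lt_pow_add_one _ _).2 (lt_of_le_of_lt ht hm2)
  refine (measure_mono hsub).trans ((haar_closedBall_pow_le a _).trans ?_)
  have : ((p : ENNReal) ^ m)⁻¹ = ENNReal.ofReal ((p : ℝ) ^ (-(m : ℤ))) := by
    rw [zpow_neg, zpow_natCast, ENNReal.ofReal_inv_of_pos (by positivity),
      ENNReal.ofReal_pow hp0.le, ENNReal.ofReal_natCast]
  rw [this]
  exact ENNReal.ofReal_le_ofReal hm1

/-! ### Sublevel estimates for logarithmic derivatives. -/

/-- Where the logarithmic derivative of a polynomial is large, a root is near. -/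
theorem exists_root_of_mul_norm_eval_lt (g : Polynomial ℚ_[p]) {A : ℝ} (hA : 0 < A) (x : ℚ_[p])
    (h : A * ‖g.eval x‖ < ‖g.derivative.eval x‖) :
    ∃ ξ ∈ (g.map (algebraMap ℚ_[p] (PadicAlgCl p))).roots,
      ‖algebraMap ℚ_[p] (PadicAlgCl p) x - ξ‖ ≤ A⁻¹ := by
  set φ := algebraMap ℚ_[p] (PadicAlgCl p) with hφ
  have hnorm : ∀ y : ℚ_[p], ‖φ y‖ = ‖y‖ := PadicAlgCl.norm_extends p
  have hg : g ≠ 0 := by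
    rintro rfl
    simp at h
  have hg' : g.map φ ≠ 0 := (Polynomial.map_ne_zero_iff φ.injective).2 hg
  have heval : (g.map φ).eval (φ x) = φ (g.eval x) := Polynomial.eval_map_apply φ x
  by_cases h0 : g.eval x = 0
  · refine ⟨φ x, (Polynomial.mem_roots hg').2 ?_, ?_⟩
    · rw [Polynomial.IsRoot, heval, h0, map_zero]
    · rw [sub_self, norm_zero]; positivity
  have heval' : (g.map φ).derivative.eval (φ x) = φ (g.derivative.eval x) := by
    rw [Polynomial.derivative_map]; exact Polynomial.eval_map_apply φ x
  have hne : (g.map φ).eval (φ x) ≠ 0 := by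
    rw [heval]; exact (map_ne_zero φ).2 h0
  -- Over the algebraic closure, `g' / g` at `x` is the sum of `1 / (x - ξ)` over the roots with
  -- multiplicity.
  have hs := (IsAlgClosed.splits (g.map φ)).eval_derivative_div_eval_of_ne_zero hne
  have hbig : A < ‖((g.map φ).roots.map fun z => 1 / (φ x - z)).sum‖ := by
    rw [← hs, norm_div, heval, heval', hnorm, hnorm, lt_div_iff₀ (norm_pos_iff.2 h0)]
    exact h
  by_contra! hcon
  have hle : ∀ s : Multiset (PadicAlgCl p), (∀ ξ ∈ s, A⁻¹ < ‖φ x - ξ‖) →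
      ‖(s.map fun z => 1 / (φ x - z)).sum‖ ≤ A := by
    intro s
    induction s using Multiset.induction with
    | empty => intro _; simpa using hA.le
    | cons a s ih =>
      intro hs
      rw [Multiset.map_cons, Multiset.sum_cons]
      refine (IsUltrametricDist.norm_add_le_max _ _).trans (max_le ?_ ?_)
      · rw [norm_div, norm_one, one_div]
        exact inv_le_of_inv_le₀ hA (hs a (Multiset.mem_cons_self a s)).le
      · exact ih fun ξ hξ => hs ξ (Multiset.mem_cons_of_mem hξ)
  exact absurd (hle _ hcon) (not_le.2 hbig)

/-- Sublevel estimate for the logarithmic derivative of a polynomial in one variable. -/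
theorem haar_logDeriv_le (g : Polynomial ℚ_[p]) {A : ℝ} (hA : 0 < A) :
    haar p {t | A * ‖g.eval (t : ℚ_[p])‖ < ‖g.derivative.eval (t : ℚ_[p])‖}
      ≤ g.natDegree * ENNReal.ofReal A⁻¹ := by
  classical
  set φ := algebraMap ℚ_[p] (PadicAlgCl p) with hφ
  have hnorm : ∀ y : ℚ_[p], ‖φ y‖ = ‖y‖ := PadicAlgCl.norm_extends p
  have hball : ∀ ξ : PadicAlgCl p,
      haar p {t | ‖φ (t : ℚ_[p]) - ξ‖ ≤ A⁻¹} ≤ ENNReal.ofReal A⁻¹ := by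
    intro ξ
    -- The centre `ξ` need not lie in `ℚ_p`; in an ultrametric space any point `a` of the ball
    -- serves as centre instead.
    rcases Set.eq_empty_or_nonempty {t : ℤ_[p] | ‖φ (t : ℚ_[p]) - ξ‖ ≤ A⁻¹} with he | ⟨a, ha⟩
    · rw [he, measure_empty]; exact zero_le
    refine (measure_mono fun t ht => ?_).trans (haar_closedBall_le a (inv_pos.2 hA))
    have e : φ ((t - a : ℤ_[p]) : ℚ_[p]) = (φ (t : ℚ_[p]) - ξ) - (φ (a : ℚ_[p]) - ξ) := by
      push_cast
      rw [map_sub]; ring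
    change ‖((t - a : ℤ_[p]) : ℚ_[p])‖ ≤ A⁻¹
    rw [← hnorm, e]
    rw [sub_eq_add_neg]
    refine (IsUltrametricDist.norm_add_le_max _ _).trans (max_le ht ?_)
    rw [norm_neg]
    exact ha
  have hsub : {t : ℤ_[p] | A * ‖g.eval (t : ℚ_[p])‖ < ‖g.derivative.eval (t : ℚ_[p])‖}
      ⊆ ⋃ ξ ∈ (g.map φ).roots.toFinset, {t | ‖φ (t : ℚ_[p]) - ξ‖ ≤ A⁻¹} := by
    intro t ht
    obtain ⟨ξ, h1, h2⟩ := exists_root_of_mul_norm_eval_lt g hA t ht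
    exact Set.mem_biUnion (Finset.mem_coe.2 (Multiset.mem_toFinset.2 h1)) h2
  refine (measure_mono hsub).trans ((measure_biUnion_finset_le _ _).trans ?_)
  refine (Finset.sum_le_card_nsmul _ _ _ fun ξ _ => hball ξ).trans ?_
  rw [nsmul_eq_mul]
  gcongr
  exact (Multiset.toFinset_card_le _).trans
    ((Polynomial.card_roots' _).trans Polynomial.natDegree_map_le)

/-- The restriction of a polynomial to the line through `z` in direction `j`. -/
def lineRestrict (z : Fin n → ℚ_[p]) (j : Fin n) (Q : MvPolynomial (Fin n) ℚ_[p]) :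
    Polynomial ℚ_[p] :=
  MvPolynomial.aeval (fun i => Polynomial.C (z i) + if i = j then Polynomial.X else 0) Q

theorem natDegree_lineRestrict_le (z : Fin n → ℚ_[p]) (j : Fin n)
    (Q : MvPolynomial (Fin n) ℚ_[p]) : (lineRestrict z j Q).natDegree ≤ Q.totalDegree := by
  refine (MvPolynomial.aeval_natDegree_le (n := 1) Q le_rfl _ fun i => ?_).trans_eq (mul_one _)
  split_ifs
  · compute_degree
  · simp

theorem eval_lineRestrict (z : Fin n → ℤ_[p]) (j : Fin n) (Q : MvPolynomial (Fin n) ℚ_[p])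
    (t : ℤ_[p]) : (lineRestrict (fun i => (z i : ℚ_[p])) j Q).eval (t : ℚ_[p])
      = evalAt Q (z + Pi.single j t) := by
  rw [lineRestrict, evalAt, ← Polynomial.coe_evalRingHom, MvPolynomial.aeval_def,
    MvPolynomial.eval, MvPolynomial.coe_eval₂Hom, MvPolynomial.hom_eval₂]
  congr 1
  · ext x
    simp
  · ext i
    by_cases h : i = j
    · subst h; simp
    · simp [h]

theorem derivative_lineRestrict (z : Fin n → ℚ_[p]) (j : Fin n)
    (Q : MvPolynomial (Fin n) ℚ_[p]) :
    (lineRestrict z j Q).derivative = lineRestrict z j (MvPolynomial.pderiv j Q) := by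
  unfold lineRestrict
  induction Q using MvPolynomial.induction_on with
  | C a => simp
  | add P Q hP hQ => simp [hP, hQ]
  | mul_X P i hP =>
    by_cases h : i = j
    · subst h
      simp [hP]
      ring
    · simp [hP, h, MvPolynomial.pderiv_X_of_ne h]
      ring

theorem measurableSet_lt_norm_evalAt (Q R : MvPolynomial (Fin n) ℚ_[p]) (A : ℝ) :
    MeasurableSet {z | A * ‖evalAt Q z‖ < ‖evalAt R z‖} :=
  (isOpen_lt (continuous_const.mul (continuous_evalAt Q).norm)
    (continuous_evalAt R).norm).measurableSet

instance instIsAddLeftInvariantHaarN : (haarN p n).IsAddLeftInvariant := by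
  unfold haarN; infer_instance

/-- Slicing a set in a coordinate direction. -/
theorem haarN_le_of_slices {S : Set (Fin n → ℤ_[p])} (hS : MeasurableSet S) (j : Fin n)
    {c : ENNReal} (h : ∀ z : Fin n → ℤ_[p], haar p {t : ℤ_[p] | z + Pi.single j t ∈ S} ≤ c) :
    haarN p n S ≤ c := by
  have hmeas : Measurable fun q : (Fin n → ℤ_[p]) × ℤ_[p] =>
      q.1 + (Pi.single j q.2 : Fin n → ℤ_[p]) := by
    refine Continuous.measurable ?_
    exact continuous_fst.add ((continuous_single j).comp continuous_snd)
  -- Averaging over the translations by `t e_j` replaces a splitting of the product measure into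
  -- coordinates.
  have h1 : ∀ t : ℤ_[p], haarN p n {z | z + Pi.single j t ∈ S} = haarN p n S := fun t =>
    measure_preimage_add_right _ _ _
  calc haarN p n S = ∫⁻ t, haarN p n {z | z + Pi.single j t ∈ S} ∂(haar p) := by
        simp_rw [h1]; simp
    _ = ∫⁻ z, haar p {t : ℤ_[p] | z + Pi.single j t ∈ S} ∂(haarN p n) := by
        have hT : MeasurableSet ((fun q : (Fin n → ℤ_[p]) × ℤ_[p] =>
            q.1 + (Pi.single j q.2 : Fin n → ℤ_[p])) ⁻¹' S) :=
          hmeas hS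
        have e1 := Measure.prod_apply (μ := haarN p n) (ν := haar p) hT
        have e2 := Measure.prod_apply_symm (μ := haarN p n) (ν := haar p) hT
        exact e2.symm.trans e1
    _ ≤ ∫⁻ _, c ∂(haarN p n) := lintegral_mono h
    _ = c := by simp

/-- Sublevel estimate for one partial derivative. -/
theorem haarN_logDeriv_le (Q : MvPolynomial (Fin n) ℚ_[p]) (j : Fin n) {A : ℝ} (hA : 0 < A) :
    haarN p n {z | A * ‖evalAt Q z‖ < ‖evalAt (MvPolynomial.pderiv j Q) z‖}
      ≤ Q.totalDegree * ENNReal.ofReal A⁻¹ := by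
  refine haarN_le_of_slices (measurableSet_lt_norm_evalAt _ _ _) j fun z => ?_
  have := haar_logDeriv_le (lineRestrict (fun i => (z i : ℚ_[p])) j Q) hA
  simp only [derivative_lineRestrict, eval_lineRestrict] at this
  refine this.trans ?_
  gcongr
  exact natDegree_lineRestrict_le _ _ _

/-- The composition of the partial derivatives listed in `l`. -/
def listDeriv (l : List (Fin n)) (Q : MvPolynomial (Fin n) ℚ_[p]) : MvPolynomial (Fin n) ℚ_[p] :=
  l.foldr (fun i R => MvPolynomial.pderiv i R) Q

theorem totalDegree_pderiv_le (j : Fin n) (Q : MvPolynomial (Fin n) ℚ_[p]) :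
    (MvPolynomial.pderiv j Q).totalDegree ≤ Q.totalDegree := by
  refine Finset.sup_le fun m hm => ?_
  by_contra! hlt
  rw [MvPolynomial.mem_support_iff] at hm
  refine hm (coeff_pderiv_eq_zero (k := Q.totalDegree + 1) (fun m' hm' => ?_) j m ?_)
  · refine MvPolynomial.coeff_eq_zero_of_totalDegree_lt ?_
    simp only [Finsupp.degree_apply] at hm'
    omega
  · simp only [Finsupp.degree_apply]
    simp only [Finsupp.sum] at hlt
    omega

theorem totalDegree_listDeriv_le (l : List (Fin n)) (Q : MvPolynomial (Fin n) ℚ_[p]) :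
    (listDeriv l Q).totalDegree ≤ Q.totalDegree := by
  induction l with
  | nil => exact le_rfl
  | cons j l ih => exact (totalDegree_pderiv_le j _).trans ih

/-- Sublevel estimate for an iterated derivative. -/
theorem haarN_listDeriv_le (Q : MvPolynomial (Fin n) ℚ_[p]) (l : List (Fin n)) {A : ℝ}
    (hA : 0 < A) :
    haarN p n {z | A ^ l.length * ‖evalAt Q z‖ < ‖evalAt (listDeriv l Q) z‖}
      ≤ l.length * (Q.totalDegree * ENNReal.ofReal A⁻¹) := by
  induction l with
  | nil => simp [listDeriv]
  | cons j l ih =>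
    -- If a product of quotients exceeds a power of `A`, one of the quotients exceeds `A`.
    have hsub : {z | A ^ (j :: l).length * ‖evalAt Q z‖ < ‖evalAt (listDeriv (j :: l) Q) z‖}
        ⊆ {z | A ^ l.length * ‖evalAt Q z‖ < ‖evalAt (listDeriv l Q) z‖}
          ∪ {z | A * ‖evalAt (listDeriv l Q) z‖
              < ‖evalAt (MvPolynomial.pderiv j (listDeriv l Q)) z‖} := by
      intro z hz
      by_contra! hcon
      simp only [Set.mem_union, not_or, Set.mem_ofPred_eq, not_lt] at hcon
      refine absurd hz (not_lt.2 (hcon.2.trans ?_))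
      rw [List.length_cons, pow_succ', mul_assoc]
      exact mul_le_mul_of_nonneg_left hcon.1 hA.le
    refine (measure_mono hsub).trans ((measure_union_le _ _).trans ?_)
    rw [List.length_cons, Nat.cast_succ, add_mul, one_mul]
    refine add_le_add ih ((haarN_logDeriv_le _ j hA).trans ?_)
    gcongr
    exact totalDegree_listDeriv_le l Q

/-! ### Taylor expansion and iterated derivatives. -/

/-- The polynomial `P (w + X)`. -/
def shift (w : Fin n → ℚ_[p]) :
    MvPolynomial (Fin n) ℚ_[p] →ₐ[ℚ_[p]] MvPolynomial (Fin n) ℚ_[p] :=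
  MvPolynomial.aeval fun i => MvPolynomial.X i + MvPolynomial.C (w i)

theorem shift_shift (w z : Fin n → ℚ_[p]) (P : MvPolynomial (Fin n) ℚ_[p]) :
    shift w (shift z P) = shift (z + w) P := by
  rw [← AlgHom.comp_apply]
  congr 1
  ext i : 1
  simp [shift]
  ring

theorem coeff_zero_shift (w : Fin n → ℚ_[p]) (P : MvPolynomial (Fin n) ℚ_[p]) :
    (shift w P).coeff 0 = MvPolynomial.eval w P := by
  change MvPolynomial.constantCoeff (shift w P) = _
  induction P using MvPolynomial.induction_on with
  | C a => simp [shift]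
  | add P Q hP hQ => simp only [map_add, hP, hQ]
  | mul_X P i hP => simp only [map_mul, hP]; simp [shift]

theorem pderiv_shift (i : Fin n) (w : Fin n → ℚ_[p]) (P : MvPolynomial (Fin n) ℚ_[p]) :
    MvPolynomial.pderiv i (shift w P) = shift w (MvPolynomial.pderiv i P) := by
  classical
  induction P using MvPolynomial.induction_on with
  | C a => simp [shift]
  | add P Q hP hQ => simp only [map_add, hP, hQ]
  | mul_X P j hP =>
    rw [map_mul, MvPolynomial.pderiv_mul, MvPolynomial.pderiv_mul, hP, map_add, map_mul, map_mul]
    congr 2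
    by_cases h : j = i
    · subst h; simp [shift]
    · simp [shift, MvPolynomial.pderiv_X_of_ne h]

theorem listDeriv_shift (l : List (Fin n)) (w : Fin n → ℚ_[p]) (P : MvPolynomial (Fin n) ℚ_[p]) :
    listDeriv l (shift w P) = shift w (listDeriv l P) := by
  induction l with
  | nil => rfl
  | cons i l ih =>
    change MvPolynomial.pderiv i (listDeriv l (shift w P)) = _
    rw [ih, pderiv_shift]; rfl

/-- The factorial `m!` of a multi-index. -/
def multiFact (m : Fin n →₀ ℕ) : ℕ := ∏ i, (m i).factorial

theorem multiFact_ne_zero (m : Fin n →₀ ℕ) : multiFact m ≠ 0 :=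
  Finset.prod_ne_zero_iff.2 fun _ _ => Nat.factorial_ne_zero _

theorem multiFact_add_single (m : Fin n →₀ ℕ) (i : Fin n) :
    multiFact (m + Finsupp.single i 1) = (m i + 1) * multiFact m := by
  classical
  unfold multiFact
  rw [← Finset.mul_prod_erase _ _ (Finset.mem_univ i),
    ← Finset.mul_prod_erase _ (fun j => (m j).factorial) (Finset.mem_univ i)]
  rw [Finset.prod_congr rfl (g := fun j => (m j).factorial)]
  · simp [Nat.factorial_succ, mul_assoc]
  · intro j hj
    have : i ≠ j := (Finset.ne_of_mem_erase hj).symm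
    simp [this]

/-- The multi-index counting the entries of a list. -/
def listIndex (l : List (Fin n)) : Fin n →₀ ℕ := (l.map fun i => Finsupp.single i 1).sum

/-- Only the multi-index of the list enters on the right, so the order of differentiation never has
to be discussed. -/
theorem multiFact_mul_coeff_listDeriv (l : List (Fin n)) (m : Fin n →₀ ℕ)
    (R : MvPolynomial (Fin n) ℚ_[p]) :
    (multiFact m : ℚ_[p]) * (listDeriv l R).coeff m
      = multiFact (m + listIndex l) * R.coeff (m + listIndex l) := by
  induction l generalizing m with
  | nil => simp [listDeriv, listIndex]
  | cons i l ih =>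
    have h := ih (m + Finsupp.single i 1)
    rw [multiFact_add_single] at h
    change _ * (MvPolynomial.pderiv i (listDeriv l R)).coeff m = _
    rw [MvPolynomial.coeff_pderiv]
    have e : m + listIndex (i :: l) = m + Finsupp.single i 1 + listIndex l := by
      simp [listIndex, add_assoc]
    rw [e, ← h]
    push_cast
    ring

/-- A list in which each `i` occurs `α i` times. -/
def expList (α : Fin n → ℕ) : List (Fin n) :=
  (List.finRange n).flatMap fun i => List.replicate (α i) i

theorem partialD_eq_listDeriv (α : Fin n → ℕ) (P : MvPolynomial (Fin n) ℚ_[p]) :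
    partialD α P = listDeriv (expList α) P := by
  unfold partialD expList listDeriv
  induction List.finRange n with
  | nil => rfl
  | cons i l ih =>
    rw [List.flatMap_cons, List.foldr_append, List.foldr_cons, ih]
    generalize List.foldr _ P (List.flatMap _ l) = R
    induction α i with
    | zero => rfl
    | succ a iha => rw [Function.iterate_succ_apply', iha, List.replicate_succ, List.foldr_cons]

theorem length_expList (α : Fin n → ℕ) : (expList α).length = ∑ i, α i := by
  simp [expList, List.length_flatMap, Fin.sum_univ_def]

theorem listIndex_apply (l : List (Fin n)) (i : Fin n) : listIndex l i = l.count i := by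
  classical
  induction l with
  | nil => simp [listIndex]
  | cons j l ih =>
    have e : listIndex (j :: l) = Finsupp.single j 1 + listIndex l := by simp [listIndex]
    rw [e, Finsupp.add_apply, ih, List.count_cons, Finsupp.single_apply, add_comm]
    simp

theorem listIndex_expList (m : Fin n →₀ ℕ) : listIndex (expList m) = m := by
  classical
  ext i
  rw [listIndex_apply, expList, List.count_flatMap]
  have : (List.count i ∘ fun j => List.replicate (m j) j) = fun j => if j = i then m j else 0 := by
    ext j
    simp [List.count_replicate]
  rw [this, ← Fin.sum_univ_def]
  simp

/-- The Taylor coefficients of `P` at `w` are the numbers `∂^m P(w) / m!`. -/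
theorem coeff_shift (w : Fin n → ℚ_[p]) (P : MvPolynomial (Fin n) ℚ_[p]) (m : Fin n →₀ ℕ) :
    (multiFact m : ℚ_[p]) * (shift w P).coeff m = MvPolynomial.eval w (partialD m P) := by
  have h := multiFact_mul_coeff_listDeriv (expList m) 0 (shift w P)
  rw [listDeriv_shift, coeff_zero_shift, zero_add, listIndex_expList,
    ← partialD_eq_listDeriv] at h
  rw [← h]
  simp [multiFact]

/-! ### Weighted Gauss norms and small translations. -/

/-- `‖R_m‖ ≤ r B ^ |m|` for all the coefficients `R_m` of `R`. -/
def CoeffBound (B r : ℝ) (R : MvPolynomial (Fin n) ℚ_[p]) : Prop :=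
  ∀ m, ‖R.coeff m‖ ≤ r * B ^ m.degree

theorem CoeffBound.sum {ι : Type*} {s : Finset ι} {f : ι → MvPolynomial (Fin n) ℚ_[p]} {B r : ℝ}
    (hB : 0 ≤ B) (hr : 0 ≤ r) (h : ∀ i ∈ s, CoeffBound B r (f i)) :
    CoeffBound B r (∑ i ∈ s, f i) := fun m => by
  rw [MvPolynomial.coeff_sum]
  exact IsUltrametricDist.norm_sum_le_of_forall_le_of_nonneg (by positivity) fun i hi => h i hi m

/-- For `B > 0` the bound says that the Gauss norm on the polydisc of radius `B⁻¹` is at most `r`;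
this norm is submultiplicative. -/
theorem CoeffBound.mul {Q R : MvPolynomial (Fin n) ℚ_[p]} {B r s : ℝ} (hB : 0 ≤ B) (hr : 0 ≤ r)
    (hs : 0 ≤ s) (hQ : CoeffBound B r Q) (hR : CoeffBound B s R) : CoeffBound B (r * s) (Q * R) :=
  fun m => by
  classical
  rw [MvPolynomial.coeff_mul]
  refine IsUltrametricDist.norm_sum_le_of_forall_le_of_nonneg (by positivity) fun x hx => ?_
  rw [norm_mul, ← Finset.HasAntidiagonal.mem_antidiagonal.1 hx, map_add, pow_add,
    show r * s * (B ^ x.1.degree * B ^ x.2.degree) = (r * B ^ x.1.degree) * (s * B ^ x.2.degree)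
      by ring]
  exact mul_le_mul (hQ _) (hR _) (norm_nonneg _) (by positivity)

theorem CoeffBound.C {B : ℝ} (hB : 0 ≤ B) (a : ℚ_[p]) :
    CoeffBound B ‖a‖ (MvPolynomial.C a : MvPolynomial (Fin n) ℚ_[p]) := fun m => by
  classical
  rw [MvPolynomial.coeff_C]
  split_ifs with h
  · rw [← h]; simp
  · rw [norm_zero]; positivity

theorem CoeffBound.one {B : ℝ} (hB : 0 ≤ B) :
    CoeffBound B 1 (1 : MvPolynomial (Fin n) ℚ_[p]) := by
  simpa using CoeffBound.C (n := n) hB (1 : ℚ_[p])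

theorem CoeffBound.pow {Q : MvPolynomial (Fin n) ℚ_[p]} {B r : ℝ} (hB : 0 ≤ B) (hr : 0 ≤ r)
    (hQ : CoeffBound B r Q) (k : ℕ) : CoeffBound B (r ^ k) (Q ^ k) := by
  induction k with
  | zero => simpa using CoeffBound.one hB
  | succ k ih =>
    rw [pow_succ, pow_succ]
    exact ih.mul hB (by positivity) hr hQ

theorem CoeffBound.prod {ι : Type*} {s : Finset ι} {f : ι → MvPolynomial (Fin n) ℚ_[p]} {B : ℝ}
    {r : ι → ℝ} (hB : 0 ≤ B) (hr : ∀ i, 0 ≤ r i) (h : ∀ i ∈ s, CoeffBound B (r i) (f i)) :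
    CoeffBound B (∏ i ∈ s, r i) (∏ i ∈ s, f i) := by
  classical
  induction s using Finset.induction with
  | empty => simpa using CoeffBound.one hB
  | insert a s ha ih =>
    rw [Finset.prod_insert ha, Finset.prod_insert ha]
    exact (h a (Finset.mem_insert_self a s)).mul hB (hr a)
      (Finset.prod_nonneg fun i _ => hr i) (ih fun i hi => h i (Finset.mem_insert_of_mem hi))

theorem CoeffBound.X_add_C {B : ℝ} (hB : 0 < B) (i : Fin n) {a : ℚ_[p]} (ha : ‖a‖ ≤ B⁻¹) :
    CoeffBound B B⁻¹ (MvPolynomial.X i + MvPolynomial.C a : MvPolynomial (Fin n) ℚ_[p]) :=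
  fun m => by
  classical
  rw [MvPolynomial.coeff_add, MvPolynomial.coeff_X, MvPolynomial.coeff_C]
  refine (Padic.nonarchimedean _ _).trans (max_le ?_ ?_)
  · split_ifs with h
    · rw [← h, Finsupp.degree_single, norm_one, pow_one, inv_mul_cancel₀ hB.ne']
    · rw [norm_zero]; positivity
  · split_ifs with h
    · rw [← h]; simpa using ha
    · rw [norm_zero]; positivity

/-- A translation by `w` with `|w_i| ≤ B⁻¹` maps the polydisc to itself: `X_i + w_i` has the same
Gauss norm bound `B⁻¹` as `X_i`. -/
theorem CoeffBound.shift {R : MvPolynomial (Fin n) ℚ_[p]} {B : ℝ} (hB : 0 < B)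
    (hR : CoeffBound B 1 R) {w : Fin n → ℚ_[p]} (hw : ∀ i, ‖w i‖ ≤ B⁻¹) :
    CoeffBound B 1 (shift w R) := by
  rw [PadicOsc.shift, MvPolynomial.aeval_def, MvPolynomial.eval₂_eq']
  refine CoeffBound.sum hB.le zero_le_one fun d _ => ?_
  have h1 := (CoeffBound.C (n := n) hB.le (R.coeff d)).mul hB.le (norm_nonneg _)
    (Finset.prod_nonneg fun i _ => by positivity)
    (CoeffBound.prod (s := Finset.univ) (r := fun i => B⁻¹ ^ d i) hB.le (fun i => by positivity)
      fun i _ => (CoeffBound.X_add_C hB i (hw i)).pow hB.le (by positivity) (d i))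
  intro m
  refine (h1 m).trans (mul_le_mul_of_nonneg_right ?_ (by positivity))
  rw [Finset.prod_pow_eq_pow_sum, ← Finsupp.degree_eq_sum, inv_pow, ← div_eq_mul_inv]
  exact (div_le_one (by positivity)).2 (by simpa using hR d)

/-- The part of `R` of degree at most one. -/
def affinePart (R : MvPolynomial (Fin n) ℚ_[p]) : MvPolynomial (Fin n) ℚ_[p] :=
  MvPolynomial.C (R.coeff 0)
    + ∑ i, MvPolynomial.C (R.coeff (Finsupp.single i 1)) * MvPolynomial.X i

theorem coeff_affinePart_zero (R : MvPolynomial (Fin n) ℚ_[p]) :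
    (affinePart R).coeff 0 = R.coeff 0 := by
  simp [affinePart, MvPolynomial.coeff_sum]

theorem coeff_affinePart_single (R : MvPolynomial (Fin n) ℚ_[p]) (j : Fin n) :
    (affinePart R).coeff (Finsupp.single j 1) = R.coeff (Finsupp.single j 1) := by
  classical
  have h0 : (0 : Fin n →₀ ℕ) ≠ Finsupp.single j 1 := (Finsupp.single_ne_zero.2 one_ne_zero).symm
  simp [affinePart, MvPolynomial.coeff_sum, MvPolynomial.coeff_C, h0, MvPolynomial.coeff_X,
    Finsupp.single_left_inj]

theorem coeff_affinePart_of_two_le (R : MvPolynomial (Fin n) ℚ_[p]) {m : Fin n →₀ ℕ}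
    (hm : 2 ≤ m.degree) : (affinePart R).coeff m = 0 := by
  classical
  have h0 : (0 : Fin n →₀ ℕ) ≠ m := by rintro rfl; simp at hm
  have h1 : ∀ i, Finsupp.single i 1 ≠ m := by rintro i rfl; simp at hm
  simp [affinePart, MvPolynomial.coeff_sum, MvPolynomial.coeff_C, h0, h1, MvPolynomial.coeff_X]

theorem eq_single_of_degree_eq_one {m : Fin n →₀ ℕ} (h : m.degree = 1) :
    ∃ i, m = Finsupp.single i 1 := by
  obtain ⟨i, hi⟩ := (Finsupp.range_single_one (σ := Fin n)).ge h
  exact ⟨i, hi.symm⟩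

theorem shift_affinePart (w : Fin n → ℚ_[p]) (R : MvPolynomial (Fin n) ℚ_[p]) :
    shift w (affinePart R) = affinePart R
      + MvPolynomial.C (∑ i, R.coeff (Finsupp.single i 1) * w i) := by
  simp [shift, affinePart, mul_add, Finset.sum_add_distrib, add_assoc]

/-- Translation by a small vector changes a polynomial with controlled higher coefficients in
a controlled way. -/
theorem coeffBound_shift_sub {R : MvPolynomial (Fin n) ℚ_[p]} {B : ℝ} (hB : 0 < B)
    (hR : ∀ m, 2 ≤ m.degree → ‖R.coeff m‖ ≤ B ^ m.degree) {w : Fin n → ℚ_[p]}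
    (hw : ∀ i, ‖w i‖ ≤ B⁻¹) :
    CoeffBound B 1 (shift w R - affinePart R
      - MvPolynomial.C (∑ i, R.coeff (Finsupp.single i 1) * w i)) := by
  have hT : CoeffBound B 1 (R - affinePart R) := fun m => by
    rw [MvPolynomial.coeff_sub, one_mul]
    rcases lt_or_ge m.degree 2 with h | h
    · have h0 : R.coeff m - (affinePart R).coeff m = 0 := by
        rcases Nat.le_one_iff_eq_zero_or_eq_one.1 (Nat.lt_succ_iff.1 h) with h | h
        · rw [(Finsupp.degree_eq_zero_iff m).1 h, coeff_affinePart_zero, sub_self]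
        · obtain ⟨i, rfl⟩ := eq_single_of_degree_eq_one h
          rw [coeff_affinePart_single, sub_self]
      rw [h0, norm_zero]; positivity
    · rw [coeff_affinePart_of_two_le R h, sub_zero]
      exact hR m h
  have h := hT.shift hB hw
  rw [map_sub, shift_affinePart, ← sub_sub] at h
  exact h

/-! ### Taylor coefficients and `H(z)`. -/

/-- The Taylor coefficient `∂^m P(z) / m!`. -/
def taylorCoeff (P : MvPolynomial (Fin n) ℚ_[p]) (z : Fin n → ℤ_[p]) (m : Fin n →₀ ℕ) : ℚ_[p] :=
  (shift (fun i => (z i : ℚ_[p])) P).coeff m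

theorem multiFact_mul_taylorCoeff (P : MvPolynomial (Fin n) ℚ_[p]) (z : Fin n → ℤ_[p])
    (m : Fin n →₀ ℕ) : (multiFact m : ℚ_[p]) * taylorCoeff P z m = evalAt (partialD m P) z :=
  coeff_shift _ P m

theorem cast_multiFact_ne_zero (m : Fin n →₀ ℕ) : (multiFact m : ℚ_[p]) ≠ 0 :=
  Nat.cast_ne_zero.2 (multiFact_ne_zero m)

theorem taylorCoeff_eq_div (P : MvPolynomial (Fin n) ℚ_[p]) (z : Fin n → ℤ_[p])
    (m : Fin n →₀ ℕ) : taylorCoeff P z m = evalAt (partialD m P) z / multiFact m := by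
  rw [← multiFact_mul_taylorCoeff, mul_div_cancel_left₀ _ (cast_multiFact_ne_zero m)]

theorem continuous_taylorCoeff (P : MvPolynomial (Fin n) ℚ_[p]) (m : Fin n →₀ ℕ) :
    Continuous fun z => taylorCoeff P z m := by
  simp_rw [taylorCoeff_eq_div]
  exact (continuous_evalAt _).div_const _

theorem taylorCoeff_zero (P : MvPolynomial (Fin n) ℚ_[p]) (z : Fin n → ℤ_[p]) :
    taylorCoeff P z 0 = evalAt P z :=
  coeff_zero_shift _ _

theorem taylorCoeff_single (P : MvPolynomial (Fin n) ℚ_[p]) (z : Fin n → ℤ_[p]) (i : Fin n) :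
    taylorCoeff P z (Finsupp.single i 1) = evalAt (MvPolynomial.pderiv i P) z := by
  rw [evalAt, ← coeff_zero_shift, ← pderiv_shift, MvPolynomial.coeff_pderiv]
  simp [taylorCoeff]

theorem taylorCoeff_add (P : MvPolynomial (Fin n) ℚ_[p]) (z w : Fin n → ℤ_[p])
    (m : Fin n →₀ ℕ) : taylorCoeff P (z + w) m
      = (shift (fun i => (w i : ℚ_[p])) (shift (fun i => (z i : ℚ_[p])) P)).coeff m := by
  rw [shift_shift, taylorCoeff]
  congr 2

theorem taylorCoeff_eq_zero (P : MvPolynomial (Fin n) ℚ_[p]) (z : Fin n → ℤ_[p])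
    {m : Fin n →₀ ℕ} (h : P.totalDegree < m.degree) : taylorCoeff P z m = 0 := by
  rw [taylorCoeff_eq_div, partialD_eq_zero P m (by rwa [← Finsupp.degree_eq_sum])]
  simp [evalAt]

theorem derivSize_eq (P : MvPolynomial (Fin n) ℚ_[p]) (z : Fin n → ℤ_[p]) (m : Fin n →₀ ℕ) :
    derivSize P z m = ‖taylorCoeff P z m‖ ^ (1 / (m.degree : ℝ)) := by
  rw [taylorCoeff_eq_div, Finsupp.degree_eq_sum]; rfl

theorem norm_taylorCoeff_le_of_Hfun_le {P : MvPolynomial (Fin n) ℚ_[p]} {z : Fin n → ℤ_[p]}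
    {B : ℝ} (h : Hfun P z ≤ B) {m : Fin n →₀ ℕ} (hm : 1 ≤ m.degree) :
    ‖taylorCoeff P z m‖ ≤ B ^ m.degree := by
  have h1 : derivSize P z m ≤ B :=
    (le_ciSup (bddAbove_derivSize P z) ⟨m, by rwa [← Finsupp.degree_eq_sum]⟩).trans h
  rw [derivSize_eq] at h1
  have h2 := pow_le_pow_left₀ (by positivity) h1 m.degree
  rwa [one_div, Real.rpow_inv_natCast_pow (norm_nonneg _) (by omega)] at h2

theorem exists_lt_norm_taylorCoeff_of_lt_Hfun {P : MvPolynomial (Fin n) ℚ_[p]}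
    {z : Fin n → ℤ_[p]} {B : ℝ} (hB : 0 ≤ B) (h : B < Hfun P z) :
    ∃ m : Fin n →₀ ℕ, 1 ≤ m.degree ∧ B ^ m.degree < ‖taylorCoeff P z m‖ := by
  by_contra! hcon
  refine absurd h (not_lt.2 (Real.iSup_le (fun α => ?_) hB))
  set m : Fin n →₀ ℕ := Finsupp.equivFunOnFinite.symm α.1 with hm
  have hα : α.1 = ⇑m := by rw [hm]; rfl
  have hdeg : 1 ≤ m.degree := by rw [Finsupp.degree_eq_sum, ← hα]; exact α.2
  rw [hα, derivSize_eq, one_div]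
  rw [Real.rpow_inv_le_iff_of_pos (norm_nonneg _) hB (by exact_mod_cast hdeg), Real.rpow_natCast]
  exact hcon m hdeg

/-- Discreteness of the value group gains a full factor `p`. -/
theorem pow_succ_le_norm_of_pow_lt {x : ℚ_[p]} {t : ℕ} (h : (p : ℝ) ^ t < ‖x‖) :
    (p : ℝ) ^ (t + 1) ≤ ‖x‖ := by
  by_contra! hcon
  have := (Padic.norm_le_pow_iff_norm_lt_pow_add_one x t).2 (by exact_mod_cast hcon)
  exact absurd h (not_lt.2 (by exact_mod_cast this))

/-! ### Regular sets and cancellation. -/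

/-- The points at which the partial derivative of index `i` is the first one of size `p ^ (t + 1)`,
while the higher Taylor coefficients are negligible at the scale `p ^ (-t)`. -/
def regularSet (P : MvPolynomial (Fin n) ℚ_[p]) (t : ℕ) (i : Fin n) : Set (Fin n → ℤ_[p]) :=
  {z | (∀ m : Fin n →₀ ℕ, 2 ≤ m.degree → ‖taylorCoeff P z m‖ ≤ ((p : ℝ) ^ t) ^ m.degree) ∧
    (∀ j, ‖taylorCoeff P z (Finsupp.single j 1)‖ ≤ (p : ℝ) ^ (t + 1)) ∧
    (p : ℝ) ^ t < ‖taylorCoeff P z (Finsupp.single i 1)‖ ∧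
    ∀ j < i, ‖taylorCoeff P z (Finsupp.single j 1)‖ ≤ (p : ℝ) ^ t}

theorem measurableSet_regularSet (P : MvPolynomial (Fin n) ℚ_[p]) (t : ℕ) (i : Fin n) :
    MeasurableSet (regularSet P t i) := by
  have hle : ∀ (m : Fin n →₀ ℕ) (c : ℝ), MeasurableSet {z | ‖taylorCoeff P z m‖ ≤ c} :=
    fun m c => (isClosed_le (continuous_taylorCoeff P m).norm continuous_const).measurableSet
  have hlt : ∀ (m : Fin n →₀ ℕ) (c : ℝ), MeasurableSet {z | c < ‖taylorCoeff P z m‖} :=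
    fun m c => (isOpen_lt continuous_const (continuous_taylorCoeff P m).norm).measurableSet
  unfold regularSet
  simp only [Set.ofPred_and, Set.ofPred_forall]
  exact (MeasurableSet.iInter fun m => MeasurableSet.iInter fun _ => hle m _).inter
    ((MeasurableSet.iInter fun j => hle _ _).inter ((hlt _ _).inter
      (MeasurableSet.iInter fun j => MeasurableSet.iInter fun _ => hle _ _)))

/-- The largest first order coefficient lies in `(p ^ t, p ^ (t + 1)]`, which fixes `t`; then `i` is
the first index above `p ^ t`. -/
theorem pairwise_disjoint_regularSet (P : MvPolynomial (Fin n) ℚ_[p]) :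
    Pairwise (Function.onFun Disjoint fun q : ℕ × Fin n => regularSet P q.1 q.2) := by
  have hp : (1 : ℝ) < p := by exact_mod_cast (Fact.out : p.Prime).one_lt
  have key : ∀ {z : Fin n → ℤ_[p]} {t t' : ℕ} {i i' : Fin n}, z ∈ regularSet P t i →
      z ∈ regularSet P t' i' → t' ≤ t := by
    intro z t t' i i' h h'
    have := h'.2.2.1.trans_le (h.2.1 i')
    have := (pow_lt_pow_iff_right₀ hp).1 this
    omega
  have key' : ∀ {z : Fin n → ℤ_[p]} {t : ℕ} {i i' : Fin n}, z ∈ regularSet P t i →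
      z ∈ regularSet P t i' → i' ≤ i := by
    intro z t i i' h h'
    by_contra! hlt
    exact absurd h.2.2.1 (not_lt.2 (h'.2.2.2 i hlt))
  rintro ⟨t, i⟩ ⟨t', i'⟩ hne
  refine Set.disjoint_left.2 fun z h h' => hne ?_
  obtain rfl : t = t' := le_antisymm (key h' h) (key h h')
  exact congrArg _ (le_antisymm (key' h' h) (key' h h'))

section translation

variable {P : MvPolynomial (Fin n) ℚ_[p]} {t : ℕ} {i : Fin n} {z w : Fin n → ℤ_[p]}

/-- Read in degree zero this linearizes `P` modulo `ℤ_p`; in degree one it bounds the change of the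
gradient by `p ^ t`; in higher degree it preserves the bounds on the coefficients. -/
theorem coeffBound_of_mem_regularSet (hz : z ∈ regularSet P t i)
    (hw : ∀ j, ‖w j‖ ≤ ((p : ℝ) ^ t)⁻¹) :
    CoeffBound ((p : ℝ) ^ t) 1
      (shift (fun i => (w i : ℚ_[p])) (shift (fun i => (z i : ℚ_[p])) P)
        - affinePart (shift (fun i => (z i : ℚ_[p])) P)
        - MvPolynomial.C (∑ j, taylorCoeff P z (Finsupp.single j 1) * w j)) := by
  have hp : (0 : ℝ) < p := by exact_mod_cast (Fact.out : p.Prime).pos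
  exact coeffBound_shift_sub (pow_pos hp t) hz.1 hw

theorem norm_taylorCoeff_add_sub_le (hz : z ∈ regularSet P t i)
    (hw : ∀ j, ‖w j‖ ≤ ((p : ℝ) ^ t)⁻¹) (j : Fin n) :
    ‖taylorCoeff P (z + w) (Finsupp.single j 1) - taylorCoeff P z (Finsupp.single j 1)‖
      ≤ (p : ℝ) ^ t := by
  classical
  have h := coeffBound_of_mem_regularSet hz hw (Finsupp.single j 1)
  have h0 : (0 : Fin n →₀ ℕ) ≠ Finsupp.single j 1 := (Finsupp.single_ne_zero.2 one_ne_zero).symm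
  rwa [MvPolynomial.coeff_sub, MvPolynomial.coeff_sub, MvPolynomial.coeff_C, if_neg h0, sub_zero,
    coeff_affinePart_single, ← taylorCoeff_add, Finsupp.degree_single, pow_one, one_mul] at h

theorem norm_taylorCoeff_add_le (hz : z ∈ regularSet P t i)
    (hw : ∀ j, ‖w j‖ ≤ ((p : ℝ) ^ t)⁻¹) {m : Fin n →₀ ℕ} (hm : 2 ≤ m.degree) :
    ‖taylorCoeff P (z + w) m‖ ≤ ((p : ℝ) ^ t) ^ m.degree := by
  classical
  have h := coeffBound_of_mem_regularSet hz hw m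
  have h0 : (0 : Fin n →₀ ℕ) ≠ m := by rintro rfl; simp at hm
  rwa [MvPolynomial.coeff_sub, MvPolynomial.coeff_sub, MvPolynomial.coeff_C, if_neg h0, sub_zero,
    coeff_affinePart_of_two_le _ hm, sub_zero, ← taylorCoeff_add, one_mul] at h

theorem stdChar_evalAt_add (hz : z ∈ regularSet P t i) (hw : ∀ j, ‖w j‖ ≤ ((p : ℝ) ^ t)⁻¹) :
    stdChar (evalAt P (z + w)) = stdChar (evalAt P z)
      * stdChar (∑ j, taylorCoeff P z (Finsupp.single j 1) * (w j : ℚ_[p])) := by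
  have h := coeffBound_of_mem_regularSet hz hw 0
  rw [MvPolynomial.coeff_sub, MvPolynomial.coeff_sub, MvPolynomial.coeff_zero_C,
    coeff_affinePart_zero, ← taylorCoeff_add, taylorCoeff_zero, map_zero, pow_zero, mul_one,
    sub_sub] at h
  rw [stdChar_eq_of_norm_sub_le_one h, stdChar_add]
  congr 2
  exact taylorCoeff_zero P z

/-- The gradient moves by at most `p ^ t`, which by the ultrametric inequality cannot carry a
component across the thresholds `p ^ t` and `p ^ (t + 1)`. -/
theorem add_mem_regularSet (hz : z ∈ regularSet P t i) (hw : ∀ j, ‖w j‖ ≤ ((p : ℝ) ^ t)⁻¹) :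
    z + w ∈ regularSet P t i := by
  have hp : (1 : ℝ) ≤ p := by exact_mod_cast (Fact.out : p.Prime).one_lt.le
  have hdiff := norm_taylorCoeff_add_sub_le hz hw
  have hsplit : ∀ {j : Fin n} {c : ℝ}, (p : ℝ) ^ t ≤ c →
      ‖taylorCoeff P z (Finsupp.single j 1)‖ ≤ c →
      ‖taylorCoeff P (z + w) (Finsupp.single j 1)‖ ≤ c := by
    intro j c hc h
    rw [← sub_add_cancel (taylorCoeff P (z + w) (Finsupp.single j 1))
      (taylorCoeff P z (Finsupp.single j 1))]
    exact (Padic.nonarchimedean _ _).trans (max_le ((hdiff j).trans hc) h)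
  refine ⟨fun m hm => norm_taylorCoeff_add_le hz hw hm,
    fun j => hsplit (pow_le_pow_right₀ hp t.le_succ) (hz.2.1 j), ?_,
    fun j hj => hsplit le_rfl (hz.2.2.2 j hj)⟩
  by_contra! hcon
  refine absurd hz.2.2.1 (not_lt.2 ?_)
  rw [← sub_sub_cancel (taylorCoeff P (z + w) (Finsupp.single i 1))
      (taylorCoeff P z (Finsupp.single i 1)), sub_eq_add_neg]
  refine (Padic.nonarchimedean _ _).trans (max_le hcon ?_)
  rw [norm_neg]
  exact hdiff i

end translation

theorem setIntegral_regularSet_add (P : MvPolynomial (Fin n) ℚ_[p]) (t : ℕ) (i : Fin n)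
    {w : Fin n → ℤ_[p]} (hw : ∀ j, ‖w j‖ ≤ ((p : ℝ) ^ t)⁻¹) :
    ∫ z in regularSet P t i, stdChar (evalAt P (z + w)) ∂(haarN p n)
      = ∫ z in regularSet P t i, stdChar (evalAt P z) ∂(haarN p n) := by
  have hpre : (fun z => z + w) ⁻¹' regularSet P t i = regularSet P t i := by
    ext z
    rw [Set.mem_preimage]
    constructor
    · intro h
      have hw' : ∀ j, ‖(-w) j‖ ≤ ((p : ℝ) ^ t)⁻¹ := fun j => by
        rw [Pi.neg_apply, norm_neg]; exact hw j
      have h' := add_mem_regularSet h hw'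
      rwa [add_neg_cancel_right] at h'
    · intro h
      exact add_mem_regularSet h hw
  have h := (measurePreserving_add_right (haarN p n) w).setIntegral_preimage_emb
    (MeasurableEquiv.addRight w).measurableEmbedding (fun z => stdChar (evalAt P z))
    (regularSet P t i)
  rwa [hpre] at h

/-- There is complete cancellation over each of the regular sets. -/
theorem setIntegral_regularSet (P : MvPolynomial (Fin n) ℚ_[p]) (t : ℕ) (i : Fin n) :
    ∫ z in regularSet P t i, stdChar (evalAt P z) ∂(haarN p n) = 0 := by
  classical
  have hpp : p.Prime := Fact.out
  have hp : (0 : ℝ) < p := by exact_mod_cast hpp.pos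
  -- With this `w k` the linear term is `k x` for `x = c_i p ^ t`, and `1 < |x| ≤ p` is exactly what
  -- orthogonality requires.
  set w : ℕ → Fin n → ℤ_[p] := fun k => Pi.single i ((k : ℤ_[p]) * (p : ℤ_[p]) ^ t) with hwdef
  have hw : ∀ k j, ‖w k j‖ ≤ ((p : ℝ) ^ t)⁻¹ := by
    intro k j
    by_cases h : j = i
    · subst h
      simp only [hwdef, Pi.single_eq_same]
      rw [norm_mul, norm_pow, PadicInt.norm_p, inv_pow]
      exact mul_le_of_le_one_left (by positivity) (PadicInt.norm_le_one _)
    · simp only [hwdef, Pi.single_eq_of_ne h, norm_zero]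
      positivity
  have hsum : ∀ k (z : Fin n → ℤ_[p]), ∑ j, taylorCoeff P z (Finsupp.single j 1) * (w k j : ℚ_[p])
      = (k : ℚ_[p]) * (taylorCoeff P z (Finsupp.single i 1) * (p : ℚ_[p]) ^ t) := by
    intro k z
    rw [Finset.sum_eq_single i]
    · simp only [hwdef, Pi.single_eq_same]
      push_cast
      ring
    · intro j _ hj
      simp [hwdef, Pi.single_eq_of_ne hj]
    · simp
  have hint : ∀ k, Integrable (fun z => stdChar (evalAt P (z + w k)))
      ((haarN p n).restrict (regularSet P t i)) := fun k =>
    ((integrable_stdChar_evalAt P).comp_add_right (w k)).restrict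
  have h1 : ∑ k ∈ Finset.range p,
      ∫ z in regularSet P t i, stdChar (evalAt P (z + w k)) ∂(haarN p n) = 0 := by
    rw [← integral_finsetSum _ fun k _ => hint k]
    refine setIntegral_eq_zero_of_forall_eq_zero fun z hz => ?_
    simp_rw [stdChar_evalAt_add hz (hw _), hsum]
    rw [← Finset.mul_sum, sum_stdChar_natCast_mul_eq_zero, mul_zero]
    · rw [norm_mul, norm_pow, Padic.norm_p, inv_pow, ← div_eq_mul_inv,
        one_lt_div (by positivity)]
      exact hz.2.2.1
    · rw [norm_mul, norm_pow, Padic.norm_p, inv_pow, ← div_eq_mul_inv,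
        div_le_iff₀ (by positivity), ← pow_succ']
      exact hz.2.1 i
  simp_rw [setIntegral_regularSet_add P t i (hw _)] at h1
  rw [Finset.sum_const, Finset.card_range, nsmul_eq_mul] at h1
  exact (mul_eq_zero.1 h1).resolve_left (Nat.cast_ne_zero.2 hpp.ne_zero)

/-! ### Singular sets. -/

theorem inv_natCast_le_norm {N : ℕ} (hN : N ≠ 0) : (N : ℝ)⁻¹ ≤ ‖(N : ℚ_[p])‖ := by
  have hp : (0 : ℝ) < p := by exact_mod_cast (Fact.out : p.Prime).pos
  rw [Padic.norm_eq_zpow_neg_valuation (Nat.cast_ne_zero.2 hN), Padic.valuation_natCast, zpow_neg,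
    zpow_natCast]
  refine inv_anti₀ (by positivity) ?_
  exact_mod_cast Nat.le_of_dvd (Nat.pos_of_ne_zero hN) pow_padicValNat_dvd

theorem multiFact_le (m : Fin n →₀ ℕ) : multiFact m ≤ m.degree.factorial := by
  rw [Finsupp.degree_eq_sum]
  exact Nat.le_of_dvd (Nat.factorial_pos _) (Nat.prod_factorial_dvd_factorial_sum _ _)

/-- The points at which the derivative `∂^α P` is large compared to one of the first order
derivatives. -/
def singularSet (P : MvPolynomial (Fin n) ℚ_[p]) (A : ℝ) (α : Fin n → ℕ) : Set (Fin n → ℤ_[p]) :=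
  {z | ∃ i l, expList α = l ++ [i] ∧
    A ^ l.length * ‖evalAt (MvPolynomial.pderiv i P) z‖ < ‖evalAt (partialD α P) z‖}

theorem haarN_singularSet_le (P : MvPolynomial (Fin n) ℚ_[p]) {A : ℝ} (hA : 0 < A)
    (α : Fin n → ℕ) : haarN p n (singularSet P A α)
      ≤ ENNReal.ofReal ((∑ i, α i : ℕ) * (P.totalDegree * A⁻¹)) := by
  rcases List.eq_nil_or_concat (expList α) with h | ⟨l, i, h⟩
  · have : singularSet P A α = ∅ := by
      refine Set.eq_empty_of_forall_notMem ?_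
      rintro z ⟨i, l, hl, -⟩
      rw [h] at hl
      simp at hl
    rw [this, measure_empty]; exact zero_le
  · have hlen : l.length ≤ ∑ i, α i := by
      rw [← length_expList, h]; simp
    have hsub : singularSet P A α ⊆ {z | A ^ l.length * ‖evalAt (MvPolynomial.pderiv i P) z‖
        < ‖evalAt (listDeriv l (MvPolynomial.pderiv i P)) z‖} := by
      rintro z ⟨i', l', hl, hz⟩
      rw [h, List.concat_eq_append] at hl
      -- The last entry `i` of the list is differentiated first, so the chain of derivatives starts
      -- at `∂_i P`.
      obtain ⟨rfl, hi⟩ := List.append_inj' hl rfl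
      obtain rfl : i = i' := by simpa using hi
      rw [partialD_eq_listDeriv, h] at hz
      simpa [listDeriv] using hz
    refine (measure_mono hsub).trans ((haarN_listDeriv_le _ l hA).trans ?_)
    rw [ENNReal.ofReal_mul (by positivity), ENNReal.ofReal_mul (by positivity),
      ENNReal.ofReal_natCast, ENNReal.ofReal_natCast]
    gcongr
    exact totalDegree_pderiv_le i P

theorem exists_pow_lt_le {x : ℝ} (hx : 1 < x) :
    ∃ t : ℕ, (p : ℝ) ^ t < x ∧ x ≤ (p : ℝ) ^ (t + 1) := by
  have hp : (1 : ℝ) < p := by exact_mod_cast (Fact.out : p.Prime).one_lt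
  obtain ⟨m, hm1, hm2⟩ := exists_mem_Ioc_zpow (zero_lt_one.trans hx) hp
  have hm : 0 < m + 1 := by
    by_contra! hcon
    exact absurd (hx.trans_le hm2) (not_lt.2 (zpow_le_one_of_nonpos₀ hp.le hcon))
  lift m to ℕ using by omega
  exact ⟨m, by exact_mod_cast hm1, by exact_mod_cast hm2⟩

/-- Away from the regular sets, a derivative of order at least two is large compared to the first
order derivatives. -/
theorem exists_mem_singularSet {P : MvPolynomial (Fin n) ℚ_[p]} {d : ℕ} (hd : P.totalDegree = d)
    {z : Fin n → ℤ_[p]} {t : ℕ} (h1 : (p : ℝ) ^ t < Hfun P z) (h2 : Hfun P z ≤ (p : ℝ) ^ (t + 1))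
    (hreg : ∀ i, z ∉ regularSet P t i) {A : ℝ} (hA : 0 < A)
    (hA' : A * (2 * d.factorial) ≤ (p : ℝ) ^ t) :
    ∃ α : Fin n → ℕ, ∑ i, α i ≤ d ∧ z ∈ singularSet P A α := by
  have hp : (0 : ℝ) < p := by exact_mod_cast (Fact.out : p.Prime).pos
  have hone : ∀ j, ‖taylorCoeff P z (Finsupp.single j 1)‖ ≤ (p : ℝ) ^ (t + 1) := fun j => by
    simpa using norm_taylorCoeff_le_of_Hfun_le h2 (m := Finsupp.single j 1) (by simp)
  obtain ⟨m, hm2, hm⟩ : ∃ m : Fin n →₀ ℕ, 2 ≤ m.degree ∧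
      ((p : ℝ) ^ t) ^ m.degree < ‖taylorCoeff P z m‖ := by
    by_contra! hcon
    obtain ⟨m, hm1, hm⟩ := exists_lt_norm_taylorCoeff_of_lt_Hfun (by positivity) h1
    have hm1' : m.degree = 1 := by
      by_contra hne
      exact absurd hm (not_lt.2 (hcon m (by omega)))
    obtain ⟨i, rfl⟩ := eq_single_of_degree_eq_one hm1'
    rw [hm1', pow_one] at hm
    classical
    have hex : ∃ i, (p : ℝ) ^ t < ‖taylorCoeff P z (Finsupp.single i 1)‖ := ⟨i, hm⟩
    -- Without a large coefficient of order at least two, `z` would lie in the regular set of the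
    -- first large index.
    obtain ⟨i₀, hi₀, hmin⟩ := WellFounded.has_min (wellFounded_lt (α := Fin n))
      {i | (p : ℝ) ^ t < ‖taylorCoeff P z (Finsupp.single i 1)‖} hex
    exact hreg i₀ ⟨hcon, hone, hi₀, fun j hj => not_lt.1 fun h => hmin j h hj⟩
  have hmd : m.degree ≤ d := by
    by_contra! hlt
    rw [taylorCoeff_eq_zero P z (by omega), norm_zero] at hm
    exact absurd hm (not_lt.2 (by positivity))
  obtain ⟨l, i, hl⟩ : ∃ l i, expList m = l ++ [i] := by
    rcases List.eq_nil_or_concat (expList m) with h | ⟨l, i, h⟩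
    · have := length_expList m
      rw [h, ← Finsupp.degree_eq_sum] at this
      simp at this; omega
    · exact ⟨l, i, by simpa using h⟩
  have hlen : l.length + 1 = m.degree := by
    rw [Finsupp.degree_eq_sum, ← length_expList, hl]; simp
  refine ⟨m, by rwa [← Finsupp.degree_eq_sum], i, l, hl, ?_⟩
  have hD : (0 : ℝ) < d.factorial := by exact_mod_cast d.factorial_pos
  have hD1 : (1 : ℝ) ≤ 2 * d.factorial := by
    have : (1 : ℝ) ≤ d.factorial := by exact_mod_cast d.factorial_pos
    linarith
  rw [← taylorCoeff_single, ← multiFact_mul_taylorCoeff, norm_mul]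
  -- The extra factor `p` compensates for the gradient being bounded only by `p ^ (t + 1)`.
  have hbig : (p : ℝ) ^ (t * m.degree + 1) ≤ ‖taylorCoeff P z m‖ :=
    pow_succ_le_norm_of_pow_lt (by rwa [pow_mul])
  have hfact : (d.factorial : ℝ)⁻¹ ≤ ‖(multiFact m : ℚ_[p])‖ := by
    refine le_trans ?_ (inv_natCast_le_norm (multiFact_ne_zero m))
    refine inv_anti₀ (by exact_mod_cast Nat.pos_of_ne_zero (multiFact_ne_zero m)) ?_
    exact_mod_cast (multiFact_le m).trans (Nat.factorial_le hmd)
  -- Here `l` is nonempty because `|m| ≥ 2`. The factor `d!` absorbs `|m!| ≥ 1 / d!`, and the `2`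
  -- makes the final inequality strict.
  have hApow : A ^ l.length * (2 * d.factorial) ≤ ((p : ℝ) ^ t) ^ l.length := by
    refine le_trans ?_ (pow_le_pow_left₀ (by positivity) hA' _)
    rw [mul_pow]
    exact mul_le_mul_of_nonneg_left (le_self_pow₀ hD1 (by omega)) (by positivity)
  have hkey : A ^ l.length * ‖taylorCoeff P z (Finsupp.single i 1)‖ * (2 * d.factorial)
      ≤ (p : ℝ) ^ (t * m.degree + 1) := by
    calc A ^ l.length * ‖taylorCoeff P z (Finsupp.single i 1)‖ * (2 * d.factorial)
        = (A ^ l.length * (2 * d.factorial)) * ‖taylorCoeff P z (Finsupp.single i 1)‖ := by ring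
      _ ≤ ((p : ℝ) ^ t) ^ l.length * (p : ℝ) ^ (t + 1) :=
          mul_le_mul hApow (hone i) (norm_nonneg _) (by positivity)
      _ = (p : ℝ) ^ (t * m.degree + 1) := by
          rw [← pow_mul, ← pow_add, ← hlen]; ring_nf
  have hpos : 0 < (p : ℝ) ^ (t * m.degree + 1) := by positivity
  calc A ^ l.length * ‖taylorCoeff P z (Finsupp.single i 1)‖
      ≤ (p : ℝ) ^ (t * m.degree + 1) / (2 * d.factorial) := (le_div_iff₀ (by positivity)).2 hkey
    _ < (p : ℝ) ^ (t * m.degree + 1) / d.factorial :=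
        div_lt_div_of_pos_left hpos hD (by linarith)
    _ = (d.factorial : ℝ)⁻¹ * (p : ℝ) ^ (t * m.degree + 1) := by rw [div_eq_inv_mul]
    _ ≤ ‖(multiFact m : ℚ_[p])‖ * ‖taylorCoeff P z m‖ :=
        mul_le_mul hfact hbig hpos.le (norm_nonneg _)

/-! ### The bound for the local integral. -/

theorem norm_setIntegral_stdChar_le (P : MvPolynomial (Fin n) ℚ_[p]) (S : Set (Fin n → ℤ_[p])) :
    ‖∫ z in S, stdChar (evalAt P z) ∂(haarN p n)‖ ≤ (haarN p n).real S := by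
  simpa using norm_setIntegral_le_of_norm_le_const (μ := haarN p n) (s := S) (C := 1)
    (f := fun z => stdChar (evalAt P z)) (measure_lt_top _ _) fun z _ => (norm_stdChar _).le

theorem norm_localOscInt_le (P : MvPolynomial (Fin n) ℚ_[p]) {d : ℕ} (hd : P.totalDegree = d)
    {H : ℝ} (hH : 0 < H) :
    ‖localOscInt P H‖ ≤ ((d + 1) ^ n * (d * (d * (2 * d.factorial))) + 1 : ℕ) * p * H⁻¹ := by
  have hp : (1 : ℝ) < p := by exact_mod_cast (Fact.out : p.Prime).one_lt
  have hp0 : (0 : ℝ) < p := by linarith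
  set K : ℕ := (d + 1) ^ n * (d * (d * (2 * d.factorial))) with hK
  -- For `H ≤ p` the trivial bound `1` suffices; this is the `+ 1` in the constant. For `H > p` the
  -- scale `t` is a natural number.
  rcases le_or_gt H p with hHp | hHp
  · refine ((norm_setIntegral_stdChar_le P _).trans measureReal_le_one).trans ?_
    rw [mul_assoc, ← div_eq_mul_inv]
    have h1 : 1 ≤ p / H := (one_le_div hH).2 hHp
    have h2 : (1 : ℝ) ≤ ((K + 1 : ℕ) : ℝ) := by exact_mod_cast Nat.le_add_left 1 K
    nlinarith
  set E : Set (Fin n → ℤ_[p]) := {z | H ≤ Hfun P z} with hE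
  -- On these regular sets a first order coefficient is at least `p ^ (t + 1) ≥ H`, so they lie
  -- entirely in `E`.
  let ι := {q : ℕ × Fin n // H ≤ (p : ℝ) ^ (q.1 + 1)}
  set G : Set (Fin n → ℤ_[p]) := ⋃ q : ι, regularSet P q.1.1 q.1.2 with hG
  have hGm : MeasurableSet G := MeasurableSet.iUnion fun q => measurableSet_regularSet P _ _
  have hGE : G ⊆ E := by
    refine Set.iUnion_subset fun q z hz => ?_
    by_contra hcon
    have hcon' : Hfun P z < H := not_le.1 hcon
    have h1 := pow_succ_le_norm_of_pow_lt hz.2.2.1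
    have h2 := norm_taylorCoeff_le_of_Hfun_le (le_refl (Hfun P z)) (m := Finsupp.single q.1.2 1)
      (by simp)
    rw [Finsupp.degree_single, pow_one] at h2
    linarith [q.2]
  have hGint : ∫ z in G, stdChar (evalAt P z) ∂(haarN p n) = 0 := by
    have hdisj : Pairwise (Function.onFun Disjoint fun q : ι => regularSet P q.1.1 q.1.2) :=
      fun q q' hne => pairwise_disjoint_regularSet P fun h => hne (Subtype.ext h)
    have h := integral_iUnion (μ := haarN p n) (f := fun z => stdChar (evalAt P z))
      (fun q : ι => measurableSet_regularSet P q.1.1 q.1.2) hdisj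
      (integrable_stdChar_evalAt P).integrableOn
    simpa only [setIntegral_regularSet, tsum_zero] using h
  have hsplit : localOscInt P H = ∫ z in E \ G, stdChar (evalAt P z) ∂(haarN p n) := by
    rw [setIntegral_sdiff hGm (integrable_stdChar_evalAt P).integrableOn hGE, hGint, sub_zero]
    rfl
  have hDpos : (0 : ℝ) < d.factorial := by exact_mod_cast d.factorial_pos
  -- Then `2 d! A = H / p ≤ p ^ t` for every scale that occurs. One `A` serves them all, so no
  -- summation over `t` is needed.
  set A : ℝ := H / (p * (2 * d.factorial)) with hAdef
  have hA : 0 < A := by positivity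
  set S : Finset (Fin n → ℕ) :=
    (Fintype.piFinset fun _ : Fin n => Finset.range (d + 1)).filter fun α => ∑ i, α i ≤ d with hS
  have hsub : E \ G ⊆ ⋃ α ∈ S, singularSet P A α := by
    rintro z ⟨hzE, hzG⟩
    have hzE' : H ≤ Hfun P z := hzE
    obtain ⟨t, ht1, ht2⟩ := exists_pow_lt_le (p := p) (x := Hfun P z) (by linarith)
    have hHt : H ≤ (p : ℝ) ^ (t + 1) := hzE'.trans ht2
    obtain ⟨α, hα, hz⟩ := exists_mem_singularSet hd ht1 ht2
      (fun i hi => hzG (Set.mem_iUnion.2 ⟨⟨(t, i), hHt⟩, hi⟩)) hA (by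
        rw [hAdef, div_mul_eq_mul_div, mul_div_mul_right _ _ (by positivity),
          div_le_iff₀ hp0, ← pow_succ]
        exact hHt)
    refine Set.mem_biUnion (Finset.mem_coe.2 (Finset.mem_filter.2
      ⟨Fintype.mem_piFinset.2 fun i => ?_, hα⟩)) hz
    have := Finset.single_le_sum (f := α) (fun _ _ => Nat.zero_le _) (Finset.mem_univ i)
    exact Finset.mem_range.2 (by omega)
  have hcard : S.card ≤ (d + 1) ^ n := by
    refine (Finset.card_filter_le _ _).trans ?_
    simp
  have hmeas : haarN p n (E \ G) ≤ ENNReal.ofReal ((d + 1) ^ n * (d * (d * A⁻¹))) := by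
    refine (measure_mono hsub).trans ((measure_biUnion_finset_le _ _).trans ?_)
    refine (Finset.sum_le_card_nsmul S _ (ENNReal.ofReal (d * (d * A⁻¹))) fun α hα => ?_).trans ?_
    · refine (haarN_singularSet_le P hA α).trans (ENNReal.ofReal_le_ofReal ?_)
      rw [hd]
      refine mul_le_mul_of_nonneg_right ?_ (by positivity)
      exact_mod_cast (Finset.mem_filter.1 hα).2
    · rw [nsmul_eq_mul, ENNReal.ofReal_mul (p := ((d : ℝ) + 1) ^ n) (by positivity)]
      refine mul_le_mul_left ?_ _
      rw [show ((d : ℝ) + 1) ^ n = (((d + 1) ^ n : ℕ) : ℝ) by push_cast; rfl,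
        ENNReal.ofReal_natCast]
      exact_mod_cast hcard
  rw [hsplit]
  refine (norm_setIntegral_stdChar_le P _).trans ?_
  refine (ENNReal.toReal_le_of_le_ofReal (by positivity) hmeas).trans ?_
  have e : ((d : ℝ) + 1) ^ n * (d * (d * A⁻¹)) = (K : ℝ) * p * H⁻¹ := by
    rw [hAdef, hK]
    push_cast
    field_simp
  rw [e, mul_assoc, mul_assoc]
  refine mul_le_mul_of_nonneg_right ?_ (by positivity)
  push_cast
  linarith

/-! ### Positivity of `H_P` and the complete integral. -/

/-- The Taylor coefficients of top degree are constant. -/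
theorem taylorCoeff_of_degree_eq (P : MvPolynomial (Fin n) ℚ_[p]) (z : Fin n → ℤ_[p])
    {m : Fin n →₀ ℕ} (hm : m.degree = P.totalDegree) : taylorCoeff P z m = P.coeff m := by
  classical
  have hC : partialD m P = MvPolynomial.C (multiFact m * P.coeff m) := by
    ext β
    have h := multiFact_mul_coeff_listDeriv (expList m) β P
    rw [← partialD_eq_listDeriv, listIndex_expList] at h
    rw [MvPolynomial.coeff_C]
    split_ifs with h0
    · subst h0
      simpa [multiFact] using h
    · have hβ : β.degree ≠ 0 := fun h => h0 ((Finsupp.degree_eq_zero_iff β).1 h).symm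
      have h1 : P.coeff (β + m) = 0 := by
        refine MvPolynomial.coeff_eq_zero_of_totalDegree_lt ?_
        change P.totalDegree < (β + m).degree
        rw [map_add]; omega
      rw [h1, mul_zero] at h
      exact (mul_eq_zero.1 h).resolve_left (cast_multiFact_ne_zero β)
  rw [taylorCoeff_eq_div, hC, evalAt, MvPolynomial.eval_C,
    mul_div_cancel_left₀ _ (cast_multiFact_ne_zero m)]

theorem Hinf_pos {P : MvPolynomial (Fin n) ℚ_[p]} (hd : 1 ≤ P.totalDegree) : 0 < Hinf P := by
  have hne : P.support.Nonempty := by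
    rw [Finset.nonempty_iff_ne_empty, Ne, MvPolynomial.support_eq_empty]
    rintro rfl
    simp at hd
  obtain ⟨m, hm, hdeg⟩ := Finset.exists_mem_eq_sup P.support hne fun s => s.sum fun _ e => e
  have hdeg' : m.degree = P.totalDegree := hdeg.symm
  have hpos : 0 < ‖P.coeff m‖ ^ (1 / (m.degree : ℝ)) :=
    Real.rpow_pos_of_pos (norm_pos_iff.2 (MvPolynomial.mem_support_iff.1 hm)) _
  refine hpos.trans_le (le_ciInf fun z => ?_)
  rw [← taylorCoeff_of_degree_eq P z hdeg', ← derivSize_eq]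
  exact le_ciSup (bddAbove_derivSize P z) ⟨m, by rw [← Finsupp.degree_eq_sum]; omega⟩

theorem localOscInt_Hinf (P : MvPolynomial (Fin n) ℚ_[p]) : localOscInt P (Hinf P) = oscInt P := by
  have h : {z : Fin n → ℤ_[p] | Hinf P ≤ Hfun P z} = Set.univ := by
    refine Set.eq_univ_of_forall fun z => ?_
    change Hinf P ≤ Hfun P z
    refine ciInf_le ⟨0, ?_⟩ z
    rintro _ ⟨z, rfl⟩
    exact Real.iSup_nonneg fun α => Real.rpow_nonneg (norm_nonneg _) _
  rw [localOscInt, h, Measure.restrict_univ, oscInt]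

end PadicOsc

end

theorem mainTheorem3 (d n : ℕ) :
    ∃ C : ℝ, 0 < C ∧ ∀ (p : ℕ) [Fact p.Prime] (P : MvPolynomial (Fin n) ℚ_[p]),
      P.totalDegree = d →
        (∀ H : ℝ, 0 < H → ‖PadicOsc.localOscInt P H‖ ≤ C * p * H⁻¹) ∧
        (1 ≤ d → 0 < PadicOsc.Hinf P ∧ ‖PadicOsc.oscInt P‖ ≤ C * p * (PadicOsc.Hinf P)⁻¹) := by
  refine ⟨((d + 1) ^ n * (d * (d * (2 * d.factorial))) + 1 : ℕ), by positivity,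
    fun p _ P hd => ⟨fun H hH => PadicOsc.norm_localOscInt_le P hd hH, fun h1 => ?_⟩⟩
  have hpos := PadicOsc.Hinf_pos (hd ▸ h1 : 1 ≤ P.totalDegree)
  refine ⟨hpos, ?_⟩
  rw [← PadicOsc.localOscInt_Hinf]
  exact PadicOsc.norm_localOscInt_le P hd hpos
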